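/- A \emph{$C$-set} is a set $M$ with a ternary relation $C$ such that $C(x,y,z)\to C(x,z,y)$; $C(x,y,z)\to\neg C(y,x,z)$; $C(x,y,z)\to[C(x,y,w)\vee C(w,y,z)]$; and $x\neq y\to C(x,y,y)$. It is \emph{$C$-minimal} if in every $N\equiv M$ every subset of $N$ definable with parameters is definable by a quantifier-free formula (with parameters) of the language $\{C\}$. Its canonical tree $T=T(M)$ is the quotient of $M^2$ by the equivalence relation of the preorder $(\alpha,\beta)\preccurlyeq(\gamma,\delta)\Leftrightarrow\neg C(\gamma,\alpha,\beta)\wedge\neg C(\delta,\alpha,\beta)$, with the induced order; $\alpha\in M$ is identified with the leaf $[(\alpha,\alpha)]$. Put $T^*=T$ if $T$ has a root, and $T^*=T\cup\{-\infty\}$ otherwise. For $a<y$ in $T^*$ the cone of $y$ at $a$ is $\Gamma(a,y)=\{t: a<t\wedge y\}$; the thick cone at $a$ is $\{t: t\ge a\}$; and for $b<a$ the pruned cone $\Gamma(]b,a[)$ is $\Gamma(b,a)$ minus the thick cone at $a$. Let $M$ be a finite or countable $C$-set which is $\aleph_0$-categorical (or finite) and $C$-minimal, and let $(M_i)$ be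 the partition of $M$ into the sets of realizations of the complete $1$-types over $\emptyset$. Let $\Theta_1$ be the set of $x\in T^*$ lying below elements of two different $M_i$. For $c\in\Theta_1$ let $X_c\subseteq M$ be the set of leaves $\ge c$ which lie in no cone $\Gamma(c,x)$ with $x\in\Theta_1$, $x>c$. Let $U$ be the set of suprema of (nonempty) maximal chains of $\Theta_1$; $B$ the set of branching points of $\Theta_1$; $S$ the set of $c\in\Theta_1\setminus(U\cup B)$ such that $X_c$ meets two different $M_i$; and $I$ the set of those elements of $\Theta_1\setminus(U\cup B\cup S)$ which are the infimum of a nonempty interval, on a maximal chain of $\Theta_1$, that is maximal among the intervals of this chain contained in $\{c\in\Theta_1\setminus(U\cup B\cup S): X_c\subseteq M_i\}$ for some $i$. Put $\Theta=U\cup B\cup S\cup I$, and let $\overline\Theta$ be the set of orbits of elements of $\Theta$ under $\mathrm{Aut}(M)$, ordered by: $A<B$ iff every $a\in A$ is below some $b\in B$ and every $b\in B$ is above some $a\in A$. Write $A^-$ for the predecessor of $A$ in $\overline\Theta$. Label $\overline\Theta$ as follows. - Each vertex $A$ carries its cardinality $n_A$. It also carries the number $s_A$ of the pairwise different complete theories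 $\Sigma_{A,1},\dots,\Sigma_{A,s_A}$, in the language $\{L,N,\le,\wedge\}$ (leaves, nodes, order, meet), of the cones at any $a\in A$ which contain no element of $\Theta$, together with these theories and, for each $i$, the number $k_{A,i}\in\mathbb N^{\ge1}\cup\{\infty\}$ of such cones at $a$ with theory $\Sigma_{A,i}$. - Each edge $(A^-,A)$ carries, if $\Gamma(]b,a[)\ne\emptyset$ for $b\in A^-$, $a\in A$, $b<a$, the complete theory $\Sigma_{A^-,A}$ of $\Gamma(]b,a[)$ in the language $\{L,N,\le,\wedge,V\}$, where $V(x)\Leftrightarrow x<a$; it carries no label otherwise. Then the tree $\overline\Theta$, labeled with the coefficients $n$, $s$, $k$ and the theories $\Sigma$ on its vertices and edges, has no non-trivial automorphism: every order automorphism of $\overline\Theta$ preserving all labels is the identity. -/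

import Mathlib

open FirstOrder FirstOrder.Language Set

universe u

/-! ### C-sets, ℵ₀-categoricity and C-minimality -/

/-- A `C`-set: a set equipped with a `C`-relation. -/
class CSet (M : Type u) where
  C : M → M → M → Prop
  c_swap : ∀ x y z, C x y z → C x z y
  c_asymm : ∀ x y z, C x y z → ¬ C y x z
  c_split : ∀ x y z w, C x y z → C x y w ∨ C w y z
  c_ne : ∀ x y, x ≠ y → C x y y

/-- The relation symbols of the pure language `{C}`. -/
inductive CRel : ℕ → Type
  | C : CRel 3

/-- The pure language `{C}`, with one ternary relation symbol. -/
def CLang : Language := ⟨fun _ => Empty, CRel⟩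

/-- A `C`-set as a first-order structure. -/
instance CSet.instStructure (M : Type u) [CSet M] : CLang.Structure M where
  funMap := fun f _ => f.elim
  RelMap := fun r v => match r, v with
    | CRel.C, v => CSet.C (v 0) (v 1) (v 2)

/-- `M` is `C`-minimal: in every `N ≡ M`, every set definable with parameters is
definable by a quantifier-free formula (with parameters) of the language `{C}`. -/
def CMinimal (M : Type u) [CSet M] : Prop :=
  ∀ (N : Type u) [CLang.Structure N], CLang.ElementarilyEquivalent N M →
    ∀ S : Set N, (Set.univ : Set N).Definable₁ CLang S →
      ∃ φ : (CLang[[(Set.univ : Set N)]]).Formula (Fin 1),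
        BoundedFormula.IsQF φ ∧ S = {x | φ.Realize (fun _ => x)}

/-- The complete theory of `M` is `ℵ₀`-categorical (this includes finite `M`). -/
def AlephZeroCategorical (M : Type u) [CSet M] : Prop :=
  Cardinal.aleph0.{0}.Categorical (CLang.completeTheory M)

/-- `α` and `β` have the same complete 1-type over `∅`. -/
def SameType {M : Type u} [CSet M] (α β : M) : Prop :=
  ∀ φ : CLang.Formula (Fin 1), φ.Realize (fun _ => α) ↔ φ.Realize (fun _ => β)

/-- The block of `α` in the canonical partition of `M`: all elements with the type of `α`. -/
def typeBlock {M : Type u} [CSet M] (α : M) : Set M := {β | SameType α β}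

/-! ### The canonical tree -/

/-- Pairs of elements of `M`; the pair `(α, β)` represents the node `α ∧ β`. -/
@[ext] structure CPair (M : Type u) where
  fst : M
  snd : M

/-- `(α, β) ≼ (γ, δ)` iff `¬ C(γ, α, β)` and `¬ C(δ, α, β)`. -/
instance CPair.instPreorder (M : Type u) [CSet M] : Preorder (CPair M) where
  le p q := ¬ CSet.C q.fst p.fst p.snd ∧ ¬ CSet.C q.snd p.fst p.snd
  le_refl p := by
    have irr : ∀ x z : M, ¬ CSet.C x x z := fun x z h => CSet.c_asymm x x z h h
    exact ⟨irr _ _, fun h => irr _ _ (CSet.c_swap _ _ _ h)⟩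
  le_trans p q r hpq hqr := by
    have key : ∀ e : M, ¬ CSet.C e q.fst q.snd → ¬ CSet.C e p.fst p.snd := by
      intro e he h
      have h1 := (CSet.c_split _ _ _ q.fst h).resolve_right hpq.1
      have h2 := (CSet.c_split _ _ _ q.snd h).resolve_right hpq.2
      have h3 := (CSet.c_split _ _ _ q.snd (CSet.c_swap _ _ _ h1)).resolve_left he
      have h4 := (CSet.c_split _ _ _ q.fst (CSet.c_swap _ _ _ h2)).resolve_left
        (fun h => he (CSet.c_swap _ _ _ h))
      exact CSet.c_asymm _ _ _ h3 h4
    exact ⟨key _ hqr.1, key _ hqr.2⟩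

/-- The canonical tree `T(M)`: the quotient of `M × M` by the equivalence relation
of the preorder `≼`, with the induced order. -/
abbrev CTree (M : Type u) [CSet M] : Type u := Antisymmetrization (CPair M) (· ≤ ·)

/-- `T(M)*`: the tree `T(M)` itself if it has a root, and `T(M) ∪ {-∞}` otherwise
(`⊥` plays the role of `-∞`). -/
abbrev CTreeStar (M : Type u) [CSet M] : Type u :=
  {x : WithBot (CTree M) // x = ⊥ → ¬ ∃ r : CTree M, IsBot r}

/-- An element `α` of `M`, seen as a leaf of the tree. -/
def leaf {M : Type u} [CSet M] (α : M) : CTreeStar M :=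
  ⟨((toAntisymmetrization (· ≤ ·) (⟨α, α⟩ : CPair M) : CTree M) : WithBot (CTree M)),
    fun h => absurd h (WithBot.coe_ne_bot)⟩

/-- The automorphisms of the pure `C`-set `M`. -/
abbrev CAut (M : Type u) [CSet M] : Type u := M ≃[CLang] M

theorem CAut.map_C {M : Type u} [CSet M] (g : CAut M) (x y z : M) :
    CSet.C (g x) (g y) (g z) ↔ CSet.C x y z :=
  g.map_rel (CRel.C : CLang.Relations 3) ![x, y, z]

/-- The action of an automorphism of `M` on pairs. -/
def CAut.onPairs {M : Type u} [CSet M] (g : CAut M) : CPair M →o CPair M where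
  toFun p := ⟨g p.fst, g p.snd⟩
  monotone' _ _ h := ⟨fun hc => h.1 ((g.map_C _ _ _).1 hc), fun hc => h.2 ((g.map_C _ _ _).1 hc)⟩

/-- The action of an automorphism of `M` on `T(M)*`. -/
def CAut.onTreeStar {M : Type u} [CSet M] (g : CAut M) (x : CTreeStar M) : CTreeStar M :=
  ⟨x.1.map g.onPairs.antisymmetrization, fun h => x.2 (WithBot.map_eq_bot_iff.1 h)⟩

/-! ### Cones -/

section Cones

variable {P : Type u} [PartialOrder P]

/-- The cone `Γ(a, y)` of `y` at `a`, for `a < y`: all `t` such that `t ∧ y > a`. -/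
def treeCone (a y : P) : Set P := {t | ∃ z, a < z ∧ z ≤ t ∧ z ≤ y}

/-- The set of cones at `a`. -/
def conesAt (a : P) : Set (Set P) := {G | ∃ y, a < y ∧ G = treeCone a y}

/-- The pruned cone `Γ(]b, a[)`, for `b < a`: the cone of `a` at `b` minus the thick cone
at `a`. -/
def prunedCone (b a : P) : Set P := treeCone b a \ {t | a ≤ t}

/-- `K` is a branch (maximal subchain) of `S`. -/
def IsBranchOf (S K : Set P) : Prop := Maximal (fun K' => K' ⊆ S ∧ IsChain (· ≤ ·) K') K

/-- `J` is an interval of the chain `K`. -/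
def IsIntervalOf (K J : Set P) : Prop :=
  J ⊆ K ∧ ∀ x ∈ J, ∀ y ∈ J, ∀ z ∈ K, x ≤ z → z ≤ y → z ∈ J

end Cones

/-! ### The subtree `Θ` of `T(M)*` -/

section Theta

variable (M : Type u) [CSet M]

/-- `Θ₁`: the elements of `T(M)*` lying on the branches of two elements of `M` which belong
to different blocks of the canonical partition. -/
def Theta1 : Set (CTreeStar M) :=
  {x | ∃ α β : M, ¬ SameType α β ∧ x ≤ leaf α ∧ x ≤ leaf β}

/-- Suprema of branches of `Θ₁` (there are none if `Θ₁` is empty). -/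
def ThetaU : Set (CTreeStar M) :=
  {u | ∃ K, K.Nonempty ∧ IsBranchOf (Theta1 M) K ∧ IsLUB K u}

/-- Branching points of `Θ₁`. -/
def ThetaB : Set (CTreeStar M) :=
  {b | b ∈ Theta1 M ∧ ∃ x ∈ Theta1 M, ∃ y ∈ Theta1 M, ¬ x ≤ y ∧ ¬ y ≤ x ∧ IsGLB {x, y} b}

variable {M} in
/-- The thick cone at `c` (in `M`) without the cone at `c` of the branch of `Θ₁`. -/
def offBranch (c : CTreeStar M) : Set M :=
  {γ | c ≤ leaf γ ∧ ∀ x ∈ Theta1 M, c < x → leaf γ ∉ treeCone c x}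

/-- Points of `Θ₁`, neither in `U` nor in `B`, off which two different blocks
of the canonical partition leave the branch of `Θ₁`. -/
def ThetaS : Set (CTreeStar M) :=
  {c | c ∈ Theta1 M \ (ThetaU M ∪ ThetaB M) ∧
    ∃ α ∈ offBranch c, ∃ β ∈ offBranch c, ¬ SameType α β}

variable {M} in
/-- The points of `Θ₁ \ (U ∪ B ∪ S)` off which only the block of `α` leaves the
branch of `Θ₁`. -/
def uniformPoints (α : M) : Set (CTreeStar M) :=
  {c | c ∈ Theta1 M \ (ThetaU M ∪ ThetaB M ∪ ThetaS M) ∧ offBranch c ⊆ typeBlock α}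

/-- Infima, belonging to `Θ₁ \ (U ∪ B ∪ S)`, of the maximal (nonempty) intervals on branches of
`Θ₁` along which one same block of the canonical partition leaves the branch. -/
def ThetaI : Set (CTreeStar M) :=
  {x | x ∈ Theta1 M \ (ThetaU M ∪ ThetaB M ∪ ThetaS M) ∧
    ∃ (α : M) (K J : Set (CTreeStar M)), IsBranchOf (Theta1 M) K ∧ J.Nonempty ∧
      Maximal (fun J' => IsIntervalOf K J' ∧ J' ⊆ uniformPoints α) J ∧ IsGLB J x}

/-- The tree `Θ = U ∪ B ∪ S ∪ I`. -/
def Theta : Set (CTreeStar M) := ThetaU M ∪ ThetaB M ∪ ThetaS M ∪ ThetaI M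

/-- The set `Θ̄` of orbits of elements of `Θ` under the automorphism group of `M`. -/
def ThetaBar : Set (Set (CTreeStar M)) :=
  {A | ∃ a ∈ Theta M, A = {b | ∃ g : CAut M, g.onTreeStar a = b}}

end Theta

/-! ### The labels -/

/-- Function symbols of the language `{L, N, ≤, ∧}` of good trees. -/
inductive TreeFun : ℕ → Type
  | meet : TreeFun 2

/-- Relation symbols of the language `{L, N, ≤, ∧}` of good trees. -/
inductive TreeRel : ℕ → Type
  | le : TreeRel 2
  | isLeaf : TreeRel 1
  | isNode : TreeRel 1

/-- The language `{L, N, ≤, ∧}` of good trees. -/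
def TreeLang : Language := ⟨TreeFun, TreeRel⟩

open Classical in
/-- The meet of `x` and `y` in an order (arbitrarily `x` if there is none, which does not
happen in a good tree). -/
noncomputable def orderMeet {P : Type u} [PartialOrder P] (x y : P) : P :=
  if h : ∃ z, IsGLB {x, y} z then h.choose else x

/-- A tree as a structure: the leaves are the maximal elements, the nodes are the others. -/
noncomputable instance treeStructure {P : Type u} [PartialOrder P] (G : Set P) :
    TreeLang.Structure G where
  funMap := fun f v => match f, v with
    | TreeFun.meet, v => orderMeet (v 0) (v 1)
  RelMap := fun r v => match r, v with
    | TreeRel.le, v => v 0 ≤ v 1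
    | TreeRel.isLeaf, v => IsMax (v 0)
    | TreeRel.isNode, v => ¬ IsMax (v 0)

/-- The only symbol of the language `{V}`. -/
inductive VRel : ℕ → Type
  | V : VRel 1

/-- The language `{V}`, with one unary relation symbol. -/
def VLang : Language := ⟨fun _ => Empty, VRel⟩

/-- The interpretation of `V` by a given subset. -/
@[reducible] def vStructure {P : Type u} (V : Set P) : VLang.Structure P where
  funMap := fun f _ => f.elim
  RelMap := fun r v => match r, v with
    | VRel.V, v => v 0 ∈ V

/-- The language `{L, N, ≤, ∧, V}`. -/
abbrev TreeVLang : Language := TreeLang.sum VLang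

/-- The complete theory of the tree `Γ(]b, a[)`, expanded by `V(x) ↔ x < a`. -/
noncomputable def prunedTheory {P : Type u} [PartialOrder P] (b a : P) : TreeVLang.Theory :=
  letI := vStructure {x : prunedCone b a | (x : P) < a}
  TreeVLang.completeTheory (prunedCone b a)

section Labels

variable {M : Type u} [CSet M]

/-- The number (in `ℕ ∪ {∞}`) of cones at `a` which contain no element of `Θ` and whose
complete theory is `τ`. -/
noncomputable def coneCount (a : CTreeStar M) (τ : TreeLang.Theory) : ℕ∞ :=
  {G | G ∈ conesAt a ∧ Disjoint G (Theta M) ∧ TreeLang.completeTheory G = τ}.encard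

/-- The order on antichains: every element of `A` is below one of `B`, and every element of `B`
is above one of `A`. -/
def AntichainLT (A B : Set (CTreeStar M)) : Prop :=
  (∀ a ∈ A, ∃ b ∈ B, a < b) ∧ (∀ b ∈ B, ∃ a ∈ A, a < b)

/-- `A` is the predecessor `B⁻` of `B` in `Θ̄`. -/
def IsPredOf (A B : ThetaBar M) : Prop :=
  AntichainLT A.1 B.1 ∧ ¬ ∃ D : ThetaBar M, AntichainLT A.1 D.1 ∧ AntichainLT D.1 B.1

/-- The label `n_A`: the cardinality of `A`. -/
noncomputable def labelN (A : ThetaBar M) : ℕ := A.1.ncard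

/-- The labels `Σ_{A,i}` and `k_{A,i}`: the set of the pairs `(Σ_{A,i}, k_{A,i})`, where the
theories `Σ_{A,i}` are those of the cones at the `a ∈ A` which contain no branch of `Θ`
and `k_{A,i} ≥ 1` is the number of such cones with theory `Σ_{A,i}` at any `a ∈ A`. -/
def labelK (A : ThetaBar M) : Set (TreeLang.Theory × ℕ∞) :=
  {p | p.2 ≠ 0 ∧ ∃ a ∈ A.1, coneCount a p.1 = p.2}

/-- The label `s_A`: the number of the theories `Σ_{A,i}`. -/
noncomputable def labelS (A : ThetaBar M) : ℕ := (labelK A).ncard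

/-- The label of the edge `(A, B)`, where `A = B⁻`: the set consisting of the theory `Σ_{A,B}` of
`Γ(]a, b[)` expanded by `V`, for any `a ∈ A` and `b ∈ B` with `a < b`; the empty set
if there is no such label, that is, if the pruned cones are empty. -/
def labelEdge (A B : ThetaBar M) : Set TreeVLang.Theory :=
  {τ | ∃ a ∈ A.1, ∃ b ∈ B.1, a < b ∧ (prunedCone a b).Nonempty ∧ τ = prunedTheory a b}

/-- The automorphisms of the labeled tree `Θ̄`. -/
structure IsLabeledTreeAut (σ : Equiv.Perm (ThetaBar M)) : Prop where
  lt_iff : ∀ A B, AntichainLT (σ A).1 (σ B).1 ↔ AntichainLT A.1 B.1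
  labelN_eq : ∀ A, labelN (σ A) = labelN A
  labelS_eq : ∀ A, labelS (σ A) = labelS A
  labelK_eq : ∀ A, labelK (σ A) = labelK A
  labelEdge_eq : ∀ A B, IsPredOf A B → labelEdge (σ A) (σ B) = labelEdge A B

end Labels

/-! Two facts drive the proof. Every order automorphism of `T(M)*` comes from an automorphism of `M`
(`exists_treeIso_eq`), since leaves are the maximal elements and `C` is expressed by meets. And
disjoint isomorphic cones at one node can be exchanged by such an automorphism
(`exists_orderIso_swap`). So if `a` and `a'` are successors in `Θ` of the same `b`, and their cones
at `b` are isomorphic by a map sending `a` to `a'`, then they lie in one orbit. It remains to see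
that the labels determine these cones.

`Θ` is finite: by `C`-minimality and finiteness of the number of 1-types, the type of an element is
determined by its `C`-relations to a finite set `F`, and `Θ` is then confined to nodes spanned by
`F`, suprema of branches, the bottom, and covers of such points (`finite_theta_of_agreesOver`). `Θ`
is also closed under meets, so each cone at `a` that meets `Θ` contains exactly one successor of
`a`.

Theories determine isomorphism types: cones and pruned cones inherit from `M` the finiteness of the
number of types of tuples (half of Ryll-Nardzewski, then `hasFinitelyManyTypes_of_fixing`), so
back-and-forth applies. Moreover, `n_C / n_A` is the number of successors in `C` of a point of `A`.
By induction from the top of `Θ`, the thick cones at points of `A` and of `σ A` are isomorphic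
(`exists_setIso_Ici`). An induction from the root, using the swap, then gives `σ A = A`
(`labeledTreeAut_apply_eq`). -/

/-! ### Countable categorical structures have finitely many types -/

namespace FirstOrder.Language

section Types

universe w₁ w₂ w₃ w₄

variable (L : Language.{w₁, w₂})

/-- The complete type over `∅` of a tuple. -/
def tupleType {G : Type w₃} [L.Structure G] {α : Type w₄} (x : α → G) : Set (L.Formula α) :=
  {φ | φ.Realize x}

variable {L}

theorem tupleType_comp {G G' : Type*} [L.Structure G] [L.Structure G'] {α β : Type*}
    {x : α → G} {y : α → G'} (h : tupleType L x = tupleType L y) (f : β → α) :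
    tupleType L (x ∘ f) = tupleType L (y ∘ f) := by
  ext φ
  have := Set.ext_iff.1 h (φ.relabel f)
  simpa [tupleType, Formula.realize_relabel] using this

theorem tupleType_equiv {G G' : Type*} [L.Structure G] [L.Structure G'] {α : Type*}
    (e : G ≃[L] G') (x : α → G) : tupleType L (e ∘ x) = tupleType L x := by
  ext φ
  exact StrongHomClass.realize_formula e φ

/-- Finitely many types of `n`-tuples are realized, for all `n`. -/
def HasFinitelyManyTypes (L : Language.{w₁, w₂}) (G : Type w₃) [L.Structure G] : Prop :=
  ∀ n : ℕ, (range fun x : Fin n → G => tupleType L x).Finite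

theorem HasFinitelyManyTypes.of_finite {G : Type*} [L.Structure G]
    (h : HasFinitelyManyTypes L G) (α : Type*) [Finite α] :
    (range fun x : α → G => tupleType L x).Finite := by
  obtain ⟨n, ⟨e⟩⟩ := Finite.exists_equiv_fin α
  refine ((h n).image fun p => {φ | φ.relabel e ∈ p}).subset ?_
  rintro _ ⟨x, rfl⟩
  refine ⟨_, ⟨x ∘ e.symm, rfl⟩, ?_⟩
  ext φ
  simp [tupleType, Formula.realize_relabel, Function.comp_assoc]

/-- Against each of the finitely many other types realized in `G'`, one formula true of `x`
suffices; their conjunction isolates. -/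
theorem HasFinitelyManyTypes.exists_isolating {G G' : Type*} [L.Structure G] [L.Structure G']
    (h' : HasFinitelyManyTypes L G') {α : Type*} [Finite α] (x : α → G) :
    ∃ φ : L.Formula α, φ.Realize x ∧
      ∀ y : α → G', φ.Realize y → tupleType L y = tupleType L x := by
  have hQ := (h'.of_finite α).to_subtype
  have hsep : ∀ q ∈ range (fun z : α → G' => tupleType L z), ∃ ψ : L.Formula α,
      ψ.Realize x ∧ (q ≠ tupleType L x → ψ ∉ q) := by
    rintro _ ⟨z, rfl⟩
    by_cases hz : tupleType L z = tupleType L x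
    · exact ⟨⊤, by simp, fun h => absurd hz h⟩
    · obtain ⟨ψ, hψ⟩ : ∃ ψ : L.Formula α, ¬ (ψ.Realize z ↔ ψ.Realize x) := by
        by_contra hcon
        push Not at hcon
        exact hz (Set.ext hcon)
      by_cases h1 : ψ.Realize x
      · exact ⟨ψ, h1, fun _ h2 => hψ ⟨fun _ => h1, fun _ => h2⟩⟩
      · refine ⟨ψ.not, Formula.realize_not.2 h1, fun _ h2 => ?_⟩
        exact hψ ⟨fun h3 => absurd h3 (Formula.realize_not.1 h2), fun h3 => absurd h3 h1⟩
  choose! ψ hψp hψ using hsep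
  refine ⟨Formula.iInf fun q : range (fun z : α → G' => tupleType L z) => ψ q,
    Formula.realize_iInf.2 fun q => hψp q q.2, fun y hy => ?_⟩
  by_contra hne
  exact hψ _ ⟨y, rfl⟩ hne (Formula.realize_iInf.1 hy ⟨_, y, rfl⟩)

/-- One step of back-and-forth: quantifying existentially a formula that isolates the type of `(x,
c)` gives a formula true of `x`, hence of `y`. -/
theorem exists_option_tupleType_eq {G G' : Type*} [L.Structure G] [L.Structure G']
    (h' : HasFinitelyManyTypes L G') {α : Type*} [Finite α] {x : α → G} {y : α → G'}
    (hxy : tupleType L x = tupleType L y) (c : G) :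
    ∃ d : G', tupleType L (fun o : Option α => o.elim c x) =
      tupleType L (fun o : Option α => o.elim d y) := by
  obtain ⟨Φ, hΦ, hΦ'⟩ := h'.exists_isolating (fun o : Option α => o.elim c x)
  let r : Option α → α ⊕ Unit := fun o => o.elim (Sum.inr ()) Sum.inl
  have hex : ((Φ.relabel r).iExs Unit) ∈ tupleType L x := by
    simp only [tupleType, mem_ofPred_eq, Formula.realize_iExs]
    refine ⟨fun _ => c, ?_⟩
    rw [Formula.realize_relabel]
    convert hΦ using 1
    funext o
    cases o <;> rfl
  rw [hxy] at hex
  simp only [tupleType, mem_ofPred_eq, Formula.realize_iExs] at hex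
  obtain ⟨i, hi⟩ := hex
  refine ⟨i (), ?_⟩
  rw [Formula.realize_relabel] at hi
  have hi' : Φ.Realize (fun o : Option α => o.elim (i ()) y) := by
    convert hi using 1
    funext o
    cases o <;> rfl
  exact (hΦ' _ hi').symm

/-- The finite partial maps which preserve all formulas, ordered by inclusion. -/
structure PartialElementary (L : Language.{w₁, w₂}) (G : Type w₃) (G' : Type w₄) [L.Structure G]
    [L.Structure G'] where
  graph : Set (G × G')
  finite : graph.Finite
  type_eq : tupleType L (fun p : graph => p.1.1) = tupleType L (fun p : graph => p.1.2)

namespace PartialElementary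

variable {G : Type w₃} {G' : Type w₄} [L.Structure G] [L.Structure G']

instance : Preorder (PartialElementary L G G') := Preorder.lift graph

theorem exists_fst (h' : HasFinitelyManyTypes L G') (s : PartialElementary L G G') (c : G) :
    ∃ t, s ≤ t ∧ ∃ d, (c, d) ∈ t.graph := by
  classical
  have := s.finite.to_subtype
  obtain ⟨d, hd⟩ := exists_option_tupleType_eq h' s.type_eq c
  refine ⟨⟨insert (c, d) s.graph, s.finite.insert _, ?_⟩, subset_insert _ _, d, mem_insert _ _⟩
  let f : (insert (c, d) s.graph : Set (G × G')) → Option s.graph :=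
    fun p => if hp : p.1 ∈ s.graph then some ⟨p.1, hp⟩ else none
  convert tupleType_comp hd f using 2
  · funext p
    by_cases hp : p.1 ∈ s.graph
    · simp [f, hp]
    · rw [Function.comp_apply, show f p = none from dif_neg hp]
      exact congrArg Prod.fst (p.2.resolve_right hp)
  · funext p
    by_cases hp : p.1 ∈ s.graph
    · simp [f, hp]
    · rw [Function.comp_apply, show f p = none from dif_neg hp]
      exact congrArg Prod.snd (p.2.resolve_right hp)

/-- The inverse partial map. -/
def symm (s : PartialElementary L G G') : PartialElementary L G' G where
  graph := Prod.swap ⁻¹' s.graph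
  finite := s.finite.preimage Prod.swap_injective.injOn
  type_eq := (tupleType_comp s.type_eq
    (fun p : (Prod.swap ⁻¹' s.graph : Set (G' × G)) => (⟨p.1.swap, p.2⟩ : s.graph))).symm

theorem exists_snd (h : HasFinitelyManyTypes L G) (s : PartialElementary L G G') (d : G') :
    ∃ t, s ≤ t ∧ ∃ c, (c, d) ∈ t.graph := by
  obtain ⟨t, hst, c, hc⟩ := s.symm.exists_fst h d
  exact ⟨t.symm, fun p hp => hst (show p.swap ∈ s.symm.graph from hp), c, hc⟩

end PartialElementary

/-- Back-and-forth. -/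
theorem exists_equiv_of_tupleType_eq {G : Type w₃} {G' : Type w₄} [L.Structure G] [L.Structure G']
    [Countable G] [Countable G'] (h : HasFinitelyManyTypes L G) (h' : HasFinitelyManyTypes L G')
    {α : Type*} [Finite α] {x : α → G} {y : α → G'} (hxy : tupleType L x = tupleType L y) :
    ∃ e : G ≃[L] G', ∀ i, e (x i) = y i := by
  classical
  let s₀ : PartialElementary L G G' :=
    { graph := range fun i => (x i, y i)
      finite := finite_range _
      type_eq := by
        have := tupleType_comp hxy
          (fun p : (range fun i => (x i, y i) : Set (G × G')) => p.2.choose)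
        convert this using 2
        · funext p
          exact (congrArg Prod.fst p.2.choose_spec).symm
        · funext p
          exact (congrArg Prod.snd p.2.choose_spec).symm }
  have := Encodable.ofCountable G
  have := Encodable.ofCountable G'
  let D : G ⊕ G' → Order.Cofinal (PartialElementary L G G') := fun o => match o with
    | .inl c => ⟨{t | ∃ d, (c, d) ∈ t.graph}, fun s =>
        let ⟨t, h1, h2⟩ := s.exists_fst h' c; ⟨t, h2, h1⟩⟩
    | .inr d => ⟨{t | ∃ c, (c, d) ∈ t.graph}, fun s =>
        let ⟨t, h1, h2⟩ := s.exists_snd h d; ⟨t, h2, h1⟩⟩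
  let S := Order.sequenceOfCofinals s₀ D
  have hS : Monotone S := Order.sequenceOfCofinals.monotone s₀ D
  let R : Set (G × G') := ⋃ n, (S n).graph
  have hfst : ∀ c, ∃ d, (c, d) ∈ R := fun c => by
    obtain ⟨d, hd⟩ := Order.sequenceOfCofinals.encode_mem s₀ D (.inl c)
    exact ⟨d, mem_iUnion.2 ⟨_, hd⟩⟩
  have hsnd : ∀ d, ∃ c, (c, d) ∈ R := fun d => by
    obtain ⟨c, hc⟩ := Order.sequenceOfCofinals.encode_mem s₀ D (.inr d)
    exact ⟨c, mem_iUnion.2 ⟨_, hc⟩⟩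
  -- A finite part of `R` lies in a single stage, so `R` preserves all formulas: equality makes it
  -- the graph of a bijection, atomic formulas make it an isomorphism.
  have hR : ∀ (n : ℕ) (a : Fin n → G) (b : Fin n → G'), (∀ i, (a i, b i) ∈ R) →
      tupleType L a = tupleType L b := by
    intro n a b hab
    choose k hk using fun i => mem_iUnion.1 (hab i)
    obtain ⟨K, hK⟩ := (finite_range k).bddAbove
    exact tupleType_comp (S K).type_eq
      (fun i => ⟨(a i, b i), hS (hK ⟨i, rfl⟩) (hk i)⟩)
  have heq : ∀ a b a' b', (a, b) ∈ R → (a', b') ∈ R → (a = a' ↔ b = b') := by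
    intro a b a' b' h1 h2
    have := Set.ext_iff.1 (hR 2 ![a, a'] ![b, b'] (by intro i; fin_cases i <;> simpa))
      (Term.equal (Term.var 0) (Term.var 1))
    simpa [tupleType, Formula.realize_equal] using this
  choose f hf using hfst
  choose g hg using hsnd
  let e : G ≃ G' :=
    { toFun := f
      invFun := g
      left_inv := fun a => (heq _ _ _ _ (hg (f a)) (hf a)).2 rfl
      right_inv := fun b => (heq _ _ _ _ (hf (g b)) (hg b)).1 rfl }
  refine ⟨{ e with map_fun' := ?_, map_rel' := ?_ }, ?_⟩
  · intro n F a
    have := Set.ext_iff.1 (hR (n + 1) (Fin.snoc a (Structure.funMap F a))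
      (Fin.snoc (f ∘ a) (f (Structure.funMap F a))) (by
        intro i
        refine Fin.lastCases ?_ (fun j => ?_) i
        · simpa using hf _
        · simpa using hf _))
      (Term.equal (Term.func F fun i => Term.var i.castSucc) (Term.var (Fin.last n)))
    simp only [tupleType, mem_ofPred_eq, Formula.realize_equal, Term.realize_func,
      Term.realize_var, Fin.snoc_castSucc, Fin.snoc_last, true_iff] at this
    exact this.symm
  · intro n r a
    have := Set.ext_iff.1 (hR n a (f ∘ a) fun i => hf _) (r.formula fun i => Term.var i)
    simp only [tupleType, mem_ofPred_eq, Formula.realize_rel, Term.realize_var] at this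
    exact this.symm
  · intro i
    exact (heq _ _ _ _ (hf (x i)) (mem_iUnion.2 ⟨0, show (x i, y i) ∈ s₀.graph from ⟨i, rfl⟩⟩)).1 rfl

theorem nonempty_equiv_of_completeTheory_eq {G : Type w₃} {G' : Type w₄} [L.Structure G]
    [L.Structure G'] [Countable G] [Countable G'] (h : HasFinitelyManyTypes L G)
    (h' : HasFinitelyManyTypes L G') (hT : L.completeTheory G = L.completeTheory G') :
    Nonempty (G ≃[L] G') := by
  have : tupleType L (Empty.elim : Empty → G) = tupleType L (Empty.elim : Empty → G') := by
    ext φ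
    have := Set.ext_iff.1 hT φ
    simp only [completeTheory, mem_ofPred_eq, Sentence.Realize] at this
    simp only [tupleType, mem_ofPred_eq]
    rwa [Subsingleton.elim (Empty.elim : Empty → G) default,
      Subsingleton.elim (Empty.elim : Empty → G') default]
  obtain ⟨e, -⟩ := exists_equiv_of_tupleType_eq h h' this
  exact ⟨e⟩

end Types

end FirstOrder.Language

/-! ### Ryll-Nardzewski: countably categorical structures are weakly saturated and atomic. -/

namespace FirstOrder.Language

section RyllNardzewski

universe v

open Cardinal

/-- Categoricity speaks of models in universe 0, so a countable structure from any universe is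
copied onto `ℕ`. -/
theorem Theory.exists_modelType_equiv {L : Language.{0, 0}} {K : Type v} [L.Structure K]
    [Countable K] [Infinite K] (T : L.Theory) [K ⊨ T] :
    ∃ M₀ : T.ModelType.{0, 0, 0}, #M₀ = ℵ₀ ∧ Nonempty (K ≃[L] M₀) := by
  obtain ⟨e⟩ := nonempty_equiv_of_countable (α := K) (β := ℕ)
  refine ⟨Theory.ModelType.equivInduced (M := Theory.ModelType.of T K) e, mk_nat,
    ⟨e.inducedStructureEquiv⟩⟩

variable {L : Language.{0, 0}} {M : Type u} [L.Structure M]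

theorem nonempty_equiv_of_categorical [Countable M] [Infinite M]
    (hcat : Cardinal.aleph0.{0}.Categorical (L.completeTheory M)) {N : Type v} [L.Structure N]
    [Countable N] [Infinite N] (hN : M ≅[L] N) : Nonempty (N ≃[L] M) := by
  have : N ⊨ L.completeTheory M := by
    rw [show L.completeTheory M = L.completeTheory N from hN]
    infer_instance
  obtain ⟨M₀, h1, ⟨e⟩⟩ := Theory.exists_modelType_equiv (K := M) (L.completeTheory M)
  obtain ⟨N₀, h2, ⟨f⟩⟩ := Theory.exists_modelType_equiv (K := N) (L.completeTheory M)
  obtain ⟨g⟩ := hcat N₀ M₀ h2 h1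
  exact ⟨(e.symm.comp g).comp f⟩

/-- Weak saturation of countably categorical structures. -/
theorem exists_mem_iInter_of_categorical [Countable M] [Infinite M] (hL : L.card ≤ ℵ₀)
    (hcat : Cardinal.aleph0.{0}.Categorical (L.completeTheory M)) {α : Type*} [Finite α]
    (D : ℕ → Set (α → M))
    (hD : ∀ n, (∅ : Set M).Definable L (D n)) (hne : ∀ n, ∃ x, ∀ k ≤ n, x ∈ D k) :
    ∃ x, ∀ n, x ∈ D n := by
  simp only [empty_definable_iff] at hD
  choose φ hφ using hD
  choose x hx using hne
  -- In the ultrapower the class of `n ↦ x n` satisfies every condition, since the `k`-th one holds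
  -- for all `n ≥ k`.
  let U : Ultrafilter ℕ := Filter.hyperfilter ℕ
  let P := (U : Filter ℕ).Product fun _ => M
  let z : α → P := fun i => ((fun n => x n i : ℕ → M) : P)
  have hz : ∀ k, (φ k).Realize z := by
    intro k
    refine (Ultraproduct.realize_formula_cast (φ k) fun i n => x n i).2 ?_
    have : ∀ᶠ n in (Filter.hyperfilter ℕ : Filter ℕ), k ≤ n :=
      Nat.hyperfilter_le_atTop (Filter.eventually_ge_atTop k)
    filter_upwards [this] with n hn
    have := hx n k hn
    rw [hφ] at this
    exact this
  have hMP : M ≅[L] P := by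
    ext θ
    change M ⊨ θ ↔ P ⊨ θ
    rw [Ultraproduct.sentence_realize]
    simp
  have hinf : Infinite P := hMP.infinite_iff.1 inferInstance
  -- A countable elementary substructure containing `z` is isomorphic to `M` by categoricity, which
  -- brings the witness back into `M`.
  obtain ⟨N, hzN, hN⟩ := exists_elementarySubstructure_card_eq L (range z) Cardinal.aleph0.{0} le_rfl
    (by simp) (by simpa using hL) (by simp)
  have hN' : #N = ℵ₀ := by simpa using hN
  have : Countable N := mk_le_aleph0_iff.1 hN'.le
  have : Infinite N := infinite_iff.2 hN'.ge
  obtain ⟨e⟩ := nonempty_equiv_of_categorical hcat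
    (hMP.trans N.elementarilyEquivalent.symm : M ≅[L] N)
  let y : α → N := fun i => ⟨z i, hzN ⟨i, rfl⟩⟩
  refine ⟨e ∘ y, fun n => ?_⟩
  rw [hφ]
  refine (StrongHomClass.realize_formula e (φ n)).2 ?_
  refine (N.subtype.map_formula (φ n) y).1 ?_
  exact hz n

/-- The tuple `x` lies in the atom `D` of the algebra of definable sets. -/
def IsIsolatedBy (L : Language.{0, 0}) {M : Type u} [L.Structure M] {α : Type*}
    (D : Set (α → M)) (x : α → M) : Prop :=
  (∅ : Set M).Definable L D ∧ x ∈ D ∧ ∀ E, (∅ : Set M).Definable L E → x ∈ E → D ⊆ E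

theorem IsIsolatedBy.subset_of_mem {α : Type*} {D E : Set (α → M)} {x y : α → M}
    (h : IsIsolatedBy L D x) (hy : y ∈ D) (hE : (∅ : Set M).Definable L E) (hyE : y ∈ E) :
    D ⊆ E := by
  by_cases hx : x ∈ E
  · exact h.2.2 E hE hx
  · exact absurd hyE (h.2.2 _ hE.compl hx hy)

theorem IsIsolatedBy.of_mem {α : Type*} {D : Set (α → M)} {x y : α → M}
    (h : IsIsolatedBy L D x) (hy : y ∈ D) : IsIsolatedBy L D y :=
  ⟨h.1, hy, fun _ hE hyE => h.subset_of_mem hy hE hyE⟩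

theorem IsIsolatedBy.comp {α β : Type*} [Finite α] [Finite β] {D : Set (α → M)} {x : α → M}
    (h : IsIsolatedBy L D x) (f : β → α) :
    IsIsolatedBy L ((fun g : α → M => g ∘ f) '' D) (x ∘ f) := by
  refine ⟨h.1.image_comp f, ⟨x, h.2.1, rfl⟩, fun E hE hx => ?_⟩
  rintro _ ⟨y, hy, rfl⟩
  exact h.2.2 _ (hE.preimage_comp f) hx hy

/-- Otherwise any nonempty definable subset of `E` could be shrunk to a nonempty definable set
avoiding a given tuple. Doing so along an enumeration of all tuples empties the intersection,
against weak saturation. -/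
theorem exists_isIsolatedBy_mem [Countable M] [Infinite M] (hL : L.card ≤ ℵ₀)
    (hcat : Cardinal.aleph0.{0}.Categorical (L.completeTheory M)) {α : Type*} [Finite α] {E : Set (α → M)}
    (hE : (∅ : Set M).Definable L E) (hne : E.Nonempty) :
    ∃ D, ∃ x ∈ E, IsIsolatedBy L D x := by
  classical
  by_contra! hcon
  obtain ⟨m, hm⟩ := exists_surjective_nat (α → M)
  have hstep : ∀ (A : {A : Set (α → M) // (∅ : Set M).Definable L A ∧ A.Nonempty ∧ A ⊆ E})
      (x : α → M), ∃ B : {A : Set (α → M) // (∅ : Set M).Definable L A ∧ A.Nonempty ∧ A ⊆ E},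
        B.1 ⊆ A.1 ∧ x ∉ B.1 := by
    rintro ⟨A, hA, hA', hAE⟩ x
    by_cases hx : x ∈ A
    · have := hcon A x (hAE hx)
      simp only [IsIsolatedBy, not_and, not_forall] at this
      obtain ⟨B, hB, hxB, hAB⟩ := this hA hx
      obtain ⟨y, hy, hyB⟩ := not_subset.1 hAB
      exact ⟨⟨A \ B, hA.sdiff hB, ⟨y, hy, hyB⟩, sdiff_subset.trans hAE⟩, sdiff_subset,
        fun h => h.2 hxB⟩
    · exact ⟨⟨A, hA, hA', hAE⟩, subset_rfl, hx⟩
  choose next hnext using hstep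
  let S : ℕ → {A : Set (α → M) // (∅ : Set M).Definable L A ∧ A.Nonempty ∧ A ⊆ E} :=
    fun n => Nat.rec ⟨E, hE, hne, subset_rfl⟩ (fun k A => next A (m k)) n
  have hanti : Antitone fun n => (S n).1 := antitone_nat_of_succ_le fun n => (hnext (S n) (m n)).1
  obtain ⟨x, hx⟩ := exists_mem_iInter_of_categorical hL hcat (fun n => (S n).1)
    (fun n => (S n).2.1) fun n => by
      obtain ⟨x, hx⟩ := (S n).2.2.1
      exact ⟨x, fun k hk => hanti hk hx⟩
  obtain ⟨j, rfl⟩ := hm x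
  exact (hnext (S j) (m j)).2 (hx (j + 1))

/-- The finite sets with an isolated enumeration. -/
structure IsolatedFinset (L : Language.{0, 0}) (M : Type u) [L.Structure M] where
  carrier : Finset M
  isolated : ∃ D, IsIsolatedBy L D (fun i : carrier => (i : M))

namespace IsolatedFinset

instance : Preorder (IsolatedFinset L M) := Preorder.lift carrier

theorem exists_le_of_definable [Countable M] [Infinite M] (hL : L.card ≤ ℵ₀)
    (hcat : Cardinal.aleph0.{0}.Categorical (L.completeTheory M)) (s : IsolatedFinset L M) {n : ℕ}
    (x : Fin n → s.carrier) {E : Set (Option (Fin n) → M)} (hE : (∅ : Set M).Definable L E) {a : M}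
    (ha : (fun o => o.elim a fun i => (x i : M)) ∈ E) :
    ∃ t, s ≤ t ∧ ∃ b ∈ t.carrier, (fun o => o.elim b fun i => (x i : M)) ∈ E := by
  classical
  obtain ⟨D, hD⟩ := s.isolated
  have hE' : (∅ : Set M).Definable L {z : Option s.carrier → M |
      z ∘ some ∈ D ∧ z ∘ Option.map x ∈ E} :=
    (hD.1.preimage_comp some).inter (hE.preimage_comp (Option.map x))
  have key : ∀ (b : M), (fun o : Option s.carrier => o.elim b fun i => (i : M)) ∘ Option.map x =
      fun o => o.elim b fun i => (x i : M) := by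
    intro b
    funext o
    cases o <;> rfl
  obtain ⟨D', z, ⟨hz1, hz2⟩, hz⟩ := exists_isIsolatedBy_mem hL hcat hE'
    ⟨fun o => o.elim a fun i => i, hD.2.1, by rw [key]; exact ha⟩
  -- The isolated `z` extends some tuple of `D`, perhaps not the enumeration of `s`. But the
  -- projection of `D'` is definable and meets the atom `D`, so it contains `D`, and the enumeration
  -- of `s` lifts to `D'`.
  obtain ⟨y, hy, hys⟩ := hD.subset_of_mem hz1 (hz.1.image_comp some) ⟨z, hz.2.1, rfl⟩ hD.2.1
  have hy' := hz.of_mem hy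
  have hyE := hz.2.2 _ (hE.preimage_comp (Option.map x)) hz2 hy
  have hyo : y = fun o => o.elim (y none) fun i => (i : M) := by
    funext o
    cases o with
    | none => rfl
    | some i => exact congrFun hys i
  let f : (insert (y none) s.carrier : Finset M) → Option s.carrier :=
    fun p => if hp : p.1 ∈ s.carrier then some ⟨p.1, hp⟩ else none
  refine ⟨⟨insert (y none) s.carrier, (fun g : Option s.carrier → M => g ∘ f) '' D', ?_⟩, Finset.subset_insert _ _, y none,
    Finset.mem_insert_self _ _, ?_⟩
  · convert hy'.comp f using 1
    funext p
    by_cases hp : p.1 ∈ s.carrier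
    · rw [Function.comp_apply, show f p = some ⟨p.1, hp⟩ from dif_pos hp]
      exact (congrFun hys ⟨p.1, hp⟩).symm
    · rw [Function.comp_apply, show f p = none from dif_neg hp]
      exact (Finset.mem_insert.1 p.2).resolve_right hp
  · rw [mem_preimage, hyo, key] at hyE
    exact hyE

end IsolatedFinset

/-- An increasing sequence of isolated finite sets meeting all Tarski–Vaught requirements has as
union an elementary substructure whose tuples are all isolated. Categoricity makes it isomorphic to
`M`. -/
theorem exists_isIsolatedBy [Countable M] [Infinite M] (hL : L.card ≤ ℵ₀)
    (hcat : Cardinal.aleph0.{0}.Categorical (L.completeTheory M)) {n : ℕ} (x : Fin n → M) :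
    ∃ D, IsIsolatedBy L D x := by
  classical
  have hform : ∀ n, Countable (L.BoundedFormula Empty n) := by
    intro n
    have h1 : #(Σ n, L.BoundedFormula Empty n) ≤ ℵ₀ := by
      refine BoundedFormula.card_le.trans (max_le le_rfl ?_)
      simpa using hL
    have := mk_le_aleph0_iff.1 h1
    exact (sigma_mk_injective (i := n)).countable
  let ι := Σ n : ℕ, L.BoundedFormula Empty (n + 1) × (Fin n → M)
  have : Countable ι := inferInstance
  have := Encodable.ofCountable ι
  let E : ∀ n : ℕ, L.BoundedFormula Empty (n + 1) → Set (Option (Fin n) → M) := fun n φ =>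
    {z | φ.Realize default (Fin.snoc (z ∘ some) (z none))}
  have hE : ∀ n φ, (∅ : Set M).Definable L (E n φ) := by
    intro n φ
    have h1 : (∅ : Set M).Definable L {z : Fin (n + 1) → M | φ.Realize default z} := by
      rw [empty_definable_iff]
      refine ⟨φ.toFormula.relabel (Sum.elim Empty.elim id), ?_⟩
      ext z
      rw [mem_ofPred_eq, mem_ofPred_eq, Formula.realize_relabel,
        BoundedFormula.realize_toFormula, Subsingleton.elim (_ ∘ Sum.inl) default]
      rfl
    convert h1.preimage_comp (Fin.snoc some none : Fin (n + 1) → Option (Fin n)) using 1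
    ext z
    simp only [E, mem_ofPred_eq, mem_preimage, Fin.comp_snoc]
  let s₀ : IsolatedFinset L M :=
    ⟨∅, univ, definable_univ, mem_univ _, fun F _ hF y _ => by
      rwa [Subsingleton.elim y (fun i : (∅ : Finset M) => (i : M))]⟩
  -- Each requirement is treated only once, possibly before its parameters have appeared. Hence the
  -- premise asks only that some extension contain them: the treatment then adds the parameters too.
  let 𝒟 : ι → Order.Cofinal (IsolatedFinset L M) := fun p =>
    ⟨{t | (∃ t', t ≤ t' ∧ ∀ i, p.2.2 i ∈ t'.carrier) →
        (∃ a, (fun o : Option (Fin p.1) => o.elim a p.2.2) ∈ E p.1 p.2.1) →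
        ∃ b ∈ t.carrier, (fun o : Option (Fin p.1) => o.elim b p.2.2) ∈ E p.1 p.2.1}, fun s => by
      by_cases h1 : ∃ t', s ≤ t' ∧ ∀ i, p.2.2 i ∈ t'.carrier
      · obtain ⟨s', hs, h1⟩ := h1
        by_cases h2 : ∃ a, (fun o : Option (Fin p.1) => o.elim a p.2.2) ∈ E p.1 p.2.1
        · obtain ⟨a, ha⟩ := h2
          obtain ⟨t, hst, ht⟩ := s'.exists_le_of_definable hL hcat (fun i => ⟨p.2.2 i, h1 i⟩)
            (hE _ _) ha
          exact ⟨t, fun _ _ => ht, hs.trans hst⟩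
        · exact ⟨s, fun _ h => absurd h h2, le_rfl⟩
      · exact ⟨s, fun h => absurd h h1, le_rfl⟩⟩
  let S := Order.sequenceOfCofinals s₀ 𝒟
  have hS : Monotone S := Order.sequenceOfCofinals.monotone s₀ 𝒟
  let C : Set M := ⋃ k, ((S k).carrier : Set M)
  have hC : ∀ {n : ℕ} (y : Fin n → M), (∀ i, y i ∈ C) → ∃ K, ∀ i, y i ∈ (S K).carrier := by
    intro n y hy
    choose k hk using fun i => mem_iUnion.1 (hy i)
    obtain ⟨K, hK⟩ := (finite_range k).bddAbove
    exact ⟨K, fun i => hS (hK ⟨i, rfl⟩) (hk i)⟩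
  have hTV : ∀ (n : ℕ) (φ : L.BoundedFormula Empty (n + 1)) (y : Fin n → M) (a : M),
      (∀ i, y i ∈ C) → φ.Realize default (Fin.snoc y a) →
      ∃ b ∈ C, φ.Realize default (Fin.snoc y b) := by
    intro n φ y a hy ha
    obtain ⟨K, hK⟩ := hC y hy
    let p : ι := ⟨n, φ, y⟩
    obtain ⟨b, hb, hbE⟩ := Order.sequenceOfCofinals.encode_mem s₀ 𝒟 p
      ⟨S (max K (Encodable.encode p + 1)), hS (le_max_right _ _),
        fun i => hS (le_max_left _ _) (hK i)⟩ ⟨a, ha⟩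
    exact ⟨b, mem_iUnion.2 ⟨_, hb⟩, hbE⟩
  let N : L.Substructure M :=
    { carrier := C
      fun_mem := by
        intro n F y hy
        obtain ⟨b, hb, hbF⟩ := hTV n
          ((Term.func F fun i => Term.var (Sum.inr i.castSucc)).bdEqual
            (Term.var (Sum.inr (Fin.last n)))) y (Structure.funMap F y) hy (by simp)
        simp only [BoundedFormula.realize_bdEqual, Term.realize_func, Term.realize_var,
          Sum.elim_inr, Fin.snoc_castSucc, Fin.snoc_last] at hbF
        exact hbF ▸ hb }
  let N' : L.ElementarySubstructure M := ⟨N, N.isElementary_of_exists fun n φ y a ha => by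
    obtain ⟨b, hb, h⟩ := hTV n φ _ a (fun i => (y i).2) ha
    exact ⟨⟨b, hb⟩, h⟩⟩
  have hNM : M ≅[L] N' := N'.elementarilyEquivalent.symm
  have : Infinite N' := hNM.infinite_iff.1 inferInstance
  obtain ⟨e⟩ := nonempty_equiv_of_categorical hcat hNM
  let y : Fin n → N' := e.symm ∘ x
  obtain ⟨K, hK⟩ := hC (fun i => (y i : M)) fun i => (y i).2
  obtain ⟨D, hD⟩ := (S K).isolated
  have hDy := hD.comp fun i : Fin n => (⟨y i, hK i⟩ : (S K).carrier)
  refine ⟨_, hDy.of_mem ?_⟩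
  obtain ⟨φ, hφ⟩ := empty_definable_iff.1 hDy.1
  have h1 := hDy.2.1
  rw [hφ] at h1 ⊢
  have h2 : φ.Realize y := (N'.subtype.map_formula φ y).1 h1
  have h3 := (StrongHomClass.realize_formula e φ).2 h2
  have h4 : e ∘ y = x := by
    funext i
    simp [y]
  rwa [h4] at h3

/-- One half of the Ryll-Nardzewski theorem. -/
theorem hasFinitelyManyTypes_of_categorical [Countable M] (hL : L.card ≤ ℵ₀)
    (hcat : Cardinal.aleph0.{0}.Categorical (L.completeTheory M)) : HasFinitelyManyTypes L M := by
  intro n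
  rcases finite_or_infinite M with hM | hM
  · exact finite_range _
  have hne : Nonempty M := inferInstance
  obtain ⟨m, hm⟩ := exists_surjective_nat (Fin n → M)
  choose D hD using fun k => exists_isIsolatedBy hL hcat (m k)
  have htype : ∀ k, ∀ x ∈ D k, tupleType L x = tupleType L (m k) := by
    intro k x hx
    ext φ
    have hφ : (∅ : Set M).Definable L {z : Fin n → M | φ.Realize z} :=
      empty_definable_iff.2 ⟨φ, rfl⟩
    exact ⟨fun h => (hD k).subset_of_mem hx hφ h (hD k).2.1,
      fun h => (hD k).2.2 _ hφ h hx⟩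
  -- If no finitely many `D k` covered all tuples, weak saturation would give a tuple outside every
  -- `D k`, although each tuple is some `m j ∈ D j`.
  by_cases hcov : ∃ K, ∀ x, ∃ k ≤ K, x ∈ D k
  · obtain ⟨K, hK⟩ := hcov
    refine ((finite_Iic K).image fun k => tupleType L (m k)).subset ?_
    rintro _ ⟨x, rfl⟩
    obtain ⟨k, hk, hx⟩ := hK x
    exact ⟨k, hk, (htype k x hx).symm⟩
  · push Not at hcov
    obtain ⟨x, hx⟩ := exists_mem_iInter_of_categorical hL hcat (fun k => (D k)ᶜ)
      (fun k => (hD k).1.compl) hcov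
    obtain ⟨j, rfl⟩ := hm x
    exact absurd (hD j).2.1 (hx j)

theorem exists_automorphism_of_tupleType_eq {M : Type*} [L.Structure M] [Countable M]
    (h : HasFinitelyManyTypes L M) {α : Type*} [Finite α] {x y : α → M}
    (hxy : tupleType L x = tupleType L y) : ∃ e : M ≃[L] M, ∀ i, e (x i) = y i :=
  exists_equiv_of_tupleType_eq h h hxy

end RyllNardzewski

end FirstOrder.Language

/-! ### Quantifier-free definable sets of `C`-sets -/

section AgreesOver

variable {M : Type u} [CSet M]

/-- `x` and `y` satisfy the same instances of the relation `C` with parameters in `F`. -/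
def AgreesOver (F : Set M) (x y : M) : Prop :=
  ∀ u v w : Option F, CSet.C (u.elim x (↑)) (v.elim x (↑)) (w.elim x (↑)) ↔
    CSet.C (u.elim y (↑)) (v.elim y (↑)) (w.elim y (↑))

theorem CSet.irrefl (x z : M) : ¬ CSet.C x x z := fun h => CSet.c_asymm x x z h h

theorem CSet.ne_iff {x y : M} : x ≠ y ↔ CSet.C x y y :=
  ⟨CSet.c_ne x y, fun h hxy => CSet.irrefl x x (by subst hxy; exact h)⟩

theorem AgreesOver.mono {F F' : Set M} (hF : F ⊆ F') {x y : M} (h : AgreesOver F' x y) :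
    AgreesOver F x y := by
  intro u v w
  have key : ∀ (z : M) (o : Option F),
      (o.elim z (↑) : M) = (o.map (inclusion hF)).elim z (↑) := by
    intro z o
    cases o <;> rfl
  simp only [key]
  exact h _ _ _

theorem AgreesOver.symm {F : Set M} {x y : M} (h : AgreesOver F x y) : AgreesOver F y x :=
  fun u v w => (h u v w).symm

/-- There are no function symbols besides the constants, so a term is the variable (`none`) or a
parameter. -/
theorem exists_option_realize_eq (t : (CLang[[(univ : Set M)]]).Term (Fin 1 ⊕ Fin 0))
    (xs : Fin 0 → M) :
    ∃ o : Option M, ∀ x : M, t.realize (Sum.elim (fun _ => x) xs) = o.elim x id := by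
  cases t with
  | var i => exact ⟨none, fun x => by
      rcases i with i | i
      · rfl
      · exact i.elim0⟩
  | @func n f ts =>
    rcases f with f | f
    · exact (f : Empty).elim
    · match n, f with
      | 0, f => exact ⟨some (f : (univ : Set M)), fun x => rfl⟩
      | n + 1, f => exact (f : PEmpty).elim

theorem exists_finite_agreesOver_realize {φ : (CLang[[(univ : Set M)]]).Formula (Fin 1)}
    (hφ : BoundedFormula.IsQF φ) : ∃ F : Set M, F.Finite ∧ ∀ x y, AgreesOver F x y →
      (φ.Realize (fun _ => x) ↔ φ.Realize (fun _ => y)) := by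
  have lift : ∀ {F : Set M} (o : Option M), (∀ m ∈ o, m ∈ F) →
      ∃ p : Option F, ∀ x, o.elim x id = p.elim x (↑) := by
    intro F o ho
    cases o with
    | none => exact ⟨none, fun _ => rfl⟩
    | some m => exact ⟨some ⟨m, ho m rfl⟩, fun _ => rfl⟩
  have ofin : ∀ o : Option M, {m | m ∈ o}.Finite := by
    intro o
    cases o with
    | none => simp
    | some m => simp
  unfold Formula.Realize
  induction hφ with
  | falsum => exact ⟨∅, finite_empty, fun _ _ _ => Iff.rfl⟩
  | of_isAtomic h =>
    cases h with
    | equal t₁ t₂ =>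
      obtain ⟨o₁, h₁⟩ := exists_option_realize_eq t₁ default
      obtain ⟨o₂, h₂⟩ := exists_option_realize_eq t₂ default
      refine ⟨{m | m ∈ o₁} ∪ {m | m ∈ o₂}, (ofin _).union (ofin _), fun x y hxy => ?_⟩
      obtain ⟨p₁, hp₁⟩ := lift (F := {m | m ∈ o₁} ∪ {m | m ∈ o₂}) o₁ fun m hm => Or.inl hm
      obtain ⟨p₂, hp₂⟩ := lift (F := {m | m ∈ o₁} ∪ {m | m ∈ o₂}) o₂ fun m hm => Or.inr hm
      simp only [BoundedFormula.realize_bdEqual, h₁, h₂, hp₁, hp₂]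
      -- Equality needs no separate clause in `AgreesOver`: distinctness is an instance of `C`.
      rw [← not_iff_not, ← ne_eq, ← ne_eq, CSet.ne_iff, CSet.ne_iff]
      exact hxy _ _ _
    | @rel n R ts =>
      choose o ho using fun i => exists_option_realize_eq (ts i) default
      rcases R with R | R
      · cases R with
        | C =>
          refine ⟨⋃ i, {m | m ∈ o i}, finite_iUnion fun i => ofin _, fun x y hxy => ?_⟩
          choose p hp using fun i => lift (F := ⋃ i, {m | m ∈ o i}) (o i)
            fun m hm => mem_iUnion.2 ⟨i, hm⟩
          have key : ∀ z : M, BoundedFormula.Realize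
              (Relations.boundedFormula (L := CLang[[(univ : Set M)]]) (Sum.inl CRel.C) ts)
              (fun _ => z) default ↔
              CSet.C ((p 0).elim z (↑)) ((p 1).elim z (↑)) ((p 2).elim z (↑)) := by
            intro z
            rw [← hp, ← hp, ← hp, ← ho, ← ho, ← ho]
            rfl
          exact (key x).trans ((hxy _ _ _).trans (key y).symm)
      · exact (R : Empty).elim
  | imp _ _ ih₁ ih₂ =>
    obtain ⟨F₁, hF₁, h₁⟩ := ih₁
    obtain ⟨F₂, hF₂, h₂⟩ := ih₂
    refine ⟨F₁ ∪ F₂, hF₁.union hF₂, fun x y hxy => ?_⟩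
    rw [BoundedFormula.realize_imp, BoundedFormula.realize_imp,
      h₁ x y (hxy.mono subset_union_left), h₂ x y (hxy.mono subset_union_right)]

/-- In a `C`-minimal structure with finitely many 1-types, the 1-type of an element is determined
by the instances of `C` over some finite set. -/
theorem CMinimal.exists_finite_agreesOver (hmin : CMinimal M) (hfin : HasFinitelyManyTypes CLang M) :
    ∃ F : Set M, F.Finite ∧ ∀ x y, AgreesOver F x y → SameType x y := by
  have hdef : ∀ α : M, (univ : Set M).Definable₁ CLang {x | SameType α x} := by
    intro α
    obtain ⟨φ, hφ, hφ'⟩ := hfin.exists_isolating (G' := M) fun _ : Fin 1 => α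
    refine Definable.mono (A := ∅) (empty_definable_iff.2 ⟨φ, ?_⟩) (empty_subset _)
    ext z
    have hz : z = fun _ => z 0 := by
      funext i
      rw [Subsingleton.elim i 0]
    refine ⟨fun h => ?_, fun h ψ => ?_⟩
    · rw [mem_ofPred_eq, hz]
      exact (h φ).1 hφ
    · rw [← hz]
      exact (Set.ext_iff.1 (hφ' z h) ψ).symm
  -- Every type has a quantifier-free definition, and one representative per type leaves finitely
  -- many formulas, hence finitely many parameters.
  choose ψ hqf hψ using fun α => hmin M (rfl) _ (hdef α)
  choose F hF hF' using fun α => exists_finite_agreesOver_realize (hqf α)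
  have hR : (range fun α : M => tupleType CLang fun _ : Fin 1 => α).Finite :=
    (hfin 1).subset (by rintro _ ⟨α, rfl⟩; exact ⟨_, rfl⟩)
  have := hR.to_subtype
  choose r hr using fun p : range fun α : M => tupleType CLang fun _ : Fin 1 => α => p.2
  refine ⟨⋃ p, F (r p), finite_iUnion fun p => hF _, fun x y hxy => ?_⟩
  let p : range fun α : M => tupleType CLang fun _ : Fin 1 => α := ⟨_, x, rfl⟩
  have hx : SameType (r p) x := fun φ => Set.ext_iff.1 (hr p) φ
  have h1 : x ∈ {z | SameType (r p) z} ↔ y ∈ {z | SameType (r p) z} := by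
    rw [hψ (r p)]
    exact hF' (r p) x y (hxy.mono (subset_iUnion (fun p => F (r p)) p))
  exact fun φ => (hx φ).symm.trans (h1.1 hx φ)

end AgreesOver

/-! ### The canonical tree as a meet-semilattice -/

namespace CTreeStar

variable {M : Type u} [CSet M]

/-- The node `α ∧ β`. -/
def node (α β : M) : CTreeStar M :=
  ⟨((toAntisymmetrization (· ≤ ·) (⟨α, β⟩ : CPair M) : CTree M) : WithBot (CTree M)),
    fun h => absurd h (WithBot.coe_ne_bot)⟩

theorem node_self (α : M) : node α α = leaf α := rfl

theorem node_le_node {α β γ δ : M} :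
    node α β ≤ node γ δ ↔ ¬ CSet.C γ α β ∧ ¬ CSet.C δ α β :=
  WithBot.coe_le_coe.trans toAntisymmetrization_le_toAntisymmetrization_iff

theorem node_le_leaf {α β γ : M} : node α β ≤ leaf γ ↔ ¬ CSet.C γ α β := by
  rw [← node_self, node_le_node, and_self_iff]

theorem C_iff_not_node_le {α β γ : M} : CSet.C α β γ ↔ ¬ node β γ ≤ leaf α := by
  rw [node_le_leaf, not_not]

theorem isBot_or_eq_node (x : CTreeStar M) : IsBot x ∨ ∃ α β, x = node α β := by
  obtain ⟨x, hx⟩ := x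
  induction x with
  | bot => exact Or.inl fun y => show (⊥ : WithBot (CTree M)) ≤ y.1 from bot_le
  | coe x =>
    induction x using Antisymmetrization.ind with
    | _ p => exact Or.inr ⟨p.1, p.2, rfl⟩

theorem le_node {x : CTreeStar M} {γ δ : M} : x ≤ node γ δ ↔ x ≤ leaf γ ∧ x ≤ leaf δ := by
  rcases isBot_or_eq_node x with hx | ⟨α, β, rfl⟩
  · simp [hx _]
  · rw [node_le_node, node_le_leaf, node_le_leaf]

theorem le_total_of_le_leaf {x y : CTreeStar M} {γ : M} (hx : x ≤ leaf γ) (hy : y ≤ leaf γ) :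
    x ≤ y ∨ y ≤ x := by
  rcases isBot_or_eq_node x with hbx | ⟨α, β, rfl⟩
  · exact Or.inl (hbx _)
  rcases isBot_or_eq_node y with hby | ⟨α', β', rfl⟩
  · exact Or.inr (hby _)
  rw [node_le_leaf] at hx hy
  -- If `c` lies above the node `a ∧ b` and `p` does not, then `p` also branches off below `a ∧ c`
  -- and `b ∧ c`. Applied to both failures of comparability, this contradicts asymmetry of `C`.
  have key : ∀ {p a b c : M}, CSet.C p a b → ¬ CSet.C c a b → CSet.C p a c ∧ CSet.C p b c :=
    fun h hc => ⟨(CSet.c_split _ _ _ _ h).resolve_right hc,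
      (CSet.c_split _ _ _ _ (CSet.c_swap _ _ _ h)).resolve_right
        fun h => hc (CSet.c_swap _ _ _ h)⟩
  by_contra! h
  simp only [node_le_node, not_and_or, not_not] at h
  rcases h with ⟨h1 | h1, h2 | h2⟩ <;> have h3 := key h1 hx <;> have h4 := key h2 hy
  · exact CSet.c_asymm _ _ _ h3.1 h4.1
  · exact CSet.c_asymm _ _ _ h3.2 h4.1
  · exact CSet.c_asymm _ _ _ h3.1 h4.2
  · exact CSet.c_asymm _ _ _ h3.2 h4.2

theorem le_total_of_le {x y z : CTreeStar M} (hx : x ≤ z) (hy : y ≤ z) : x ≤ y ∨ y ≤ x := by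
  rcases isBot_or_eq_node z with hz | ⟨γ, δ, rfl⟩
  · exact Or.inl (hx.trans (hz y))
  · exact le_total_of_le_leaf (le_node.1 hx).1 (le_node.1 hy).1

theorem exists_isGLB (x y : CTreeStar M) : ∃ z, IsGLB {x, y} z := by
  by_cases h1 : x ≤ y
  · exact ⟨x, by simp [h1], fun z hz => hz (by simp)⟩
  by_cases h2 : y ≤ x
  · exact ⟨y, by simp [h2], fun z hz => hz (by simp)⟩
  rcases isBot_or_eq_node x with hbx | ⟨α, β, rfl⟩
  · exact absurd (hbx _) h1
  rcases isBot_or_eq_node y with hby | ⟨γ, δ, rfl⟩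
  · exact absurd (hby _) h2
  have hx := le_node.1 (le_refl (node α β))
  have hy := le_node.1 (le_refl (node γ δ))
  have hn := le_node.1 (le_refl (node α γ))
  -- For incomparable nodes, any leaf above the one and any leaf above the other separate exactly
  -- where the nodes do.
  refine ⟨node α γ, ?_, fun z hz => ?_⟩
  · simp only [mem_lowerBounds, mem_insert_iff, mem_singleton_iff, forall_eq_or_imp, forall_eq]
    constructor
    · refine (le_total_of_le_leaf hn.1 hx.1).resolve_right fun h => ?_
      exact (le_total_of_le_leaf (h.trans hn.2) hy.1).elim h1 h2
    · refine (le_total_of_le_leaf hn.2 hy.1).resolve_right fun h => ?_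
      exact (le_total_of_le_leaf (h.trans hn.1) hx.1).elim h2 h1
  · have hzx : z ≤ node α β := hz (by simp)
    have hzy : z ≤ node γ δ := hz (by simp)
    exact le_node.2 ⟨hzx.trans hx.1, hzy.trans hy.1⟩

noncomputable instance : SemilatticeInf (CTreeStar M) where
  inf x y := (exists_isGLB x y).choose
  inf_le_left x y := (exists_isGLB x y).choose_spec.1 (by simp)
  inf_le_right x y := (exists_isGLB x y).choose_spec.1 (by simp)
  le_inf x y z h1 h2 := (exists_isGLB y z).choose_spec.2 (by simp [h1, h2])

theorem leaf_inf_leaf (α β : M) : leaf α ⊓ leaf β = node α β :=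
  le_antisymm (le_node.2 ⟨inf_le_left, inf_le_right⟩)
    (le_inf (le_node.1 le_rfl).1 (le_node.1 le_rfl).2)

/-- This recovers the `C`-relation from the order of the tree. -/
theorem C_iff {α β γ : M} : CSet.C α β γ ↔ ¬ leaf β ⊓ leaf γ ≤ leaf α := by
  rw [leaf_inf_leaf, C_iff_not_node_le]

theorem isBot_or_eq_inf (x : CTreeStar M) : IsBot x ∨ ∃ α β, x = leaf α ⊓ leaf β := by
  simpa only [leaf_inf_leaf] using isBot_or_eq_node x

theorem leaf_le_leaf {α β : M} : leaf α ≤ leaf β ↔ α = β := by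
  refine ⟨fun h => ?_, fun h => h ▸ le_rfl⟩
  rw [← node_self, node_le_leaf, ← CSet.ne_iff, not_not] at h
  exact h.symm

theorem leaf_injective : Function.Injective (leaf : M → CTreeStar M) :=
  fun _ _ h => leaf_le_leaf.1 h.le

theorem isMax_leaf (α : M) : IsMax (leaf α) := by
  intro x hx
  rcases isBot_or_eq_node x with h | ⟨γ, δ, rfl⟩
  · exact h _
  · obtain ⟨h1, h2⟩ := le_node.1 hx
    rw [leaf_le_leaf] at h1 h2
    rw [← h1, ← h2, node_self]

theorem exists_le_leaf [Nonempty M] (x : CTreeStar M) : ∃ α, x ≤ leaf α := by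
  rcases isBot_or_eq_node x with h | ⟨γ, δ, rfl⟩
  · exact ⟨Classical.arbitrary M, h _⟩
  · exact ⟨γ, (le_node.1 le_rfl).1⟩

theorem eq_leaf_of_isMax [Nonempty M] {x : CTreeStar M} (hx : IsMax x) : ∃ α, x = leaf α := by
  obtain ⟨α, hα⟩ := exists_le_leaf x
  exact ⟨α, le_antisymm hα (hx hα)⟩

instance [Countable M] : Countable (CTreeStar M) := by
  have : Countable (CPair M) :=
    Function.Injective.countable (f := fun p : CPair M => (p.fst, p.snd)) fun p q h =>
      CPair.ext (congrArg Prod.fst h) (congrArg Prod.snd h)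
  have : Countable (CTree M) := Quotient.countable
  have : Countable (WithBot (CTree M)) := inferInstanceAs (Countable (Option (CTree M)))
  exact Subtype.countable

/-! #### Action of the automorphisms -/

theorem onTreeStar_monotone (g : CAut M) : Monotone g.onTreeStar := fun x y h =>
  show x.1.map _ ≤ y.1.map _ from
    (g.onPairs.antisymmetrization.monotone.withBot_map : Monotone _) h

theorem onTreeStar_symm_apply (g h : CAut M) (hgh : ∀ α, g (h α) = α) (x : CTreeStar M) :
    g.onTreeStar (h.onTreeStar x) = x := by
  obtain ⟨x, hx⟩ := x
  induction x with
  | bot => rfl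
  | coe x =>
    induction x using Antisymmetrization.ind with
    | _ p =>
      change node (g (h p.1)) (g (h p.2)) = node p.1 p.2
      rw [hgh, hgh]

/-- The action of an automorphism of `M` on `T(M)*` as an order isomorphism. -/
def treeIso (g : CAut M) : CTreeStar M ≃o CTreeStar M :=
  Equiv.toOrderIso
    { toFun := g.onTreeStar
      invFun := CAut.onTreeStar g.symm
      left_inv := onTreeStar_symm_apply _ _ g.symm_apply_apply
      right_inv := onTreeStar_symm_apply _ _ g.apply_symm_apply }
    (onTreeStar_monotone g) (onTreeStar_monotone _)

theorem treeIso_leaf (g : CAut M) (α : M) : treeIso g (leaf α) = leaf (g α) := rfl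

/-- The leaves are the maximal elements, so `e` permutes them, preserving `C` by `C_iff`. All nodes
but a possible bottom are meets of leaves, so this permutation determines `e`. -/
theorem exists_treeIso_eq [Nonempty M] (e : CTreeStar M ≃o CTreeStar M) :
    ∃ g : CAut M, treeIso g = e := by
  have hf : ∀ (e : CTreeStar M ≃o CTreeStar M) α, ∃ β, e (leaf α) = leaf β := fun e α =>
    eq_leaf_of_isMax (e.isMax_apply.2 (isMax_leaf α))
  choose f hf using hf
  have hinv : ∀ (e e' : CTreeStar M ≃o CTreeStar M), (∀ x, e' (e x) = x) →
      ∀ α, f e' (f e α) = α := by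
    intro e e' h α
    apply leaf_injective
    rw [← hf, ← hf, h]
  let g : CAut M :=
    { toFun := f e
      invFun := f e.symm
      left_inv := hinv _ _ e.symm_apply_apply
      right_inv := hinv _ _ e.apply_symm_apply
      map_fun' := fun F => (F : Empty).elim
      map_rel' := fun R v => by
        cases R with
        | C =>
          change CSet.C (f e (v 0)) (f e (v 1)) (f e (v 2)) ↔ CSet.C (v 0) (v 1) (v 2)
          rw [C_iff, C_iff, ← hf, ← hf, ← hf, ← e.map_inf, e.le_iff_le] }
  refine ⟨g, OrderIso.ext (funext fun x => ?_)⟩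
  have hleaf : ∀ α, treeIso g (leaf α) = e (leaf α) := fun α => (hf e α).symm
  rcases isBot_or_eq_inf x with h | ⟨α, β, rfl⟩
  · have hbot : ∀ e' : CTreeStar M ≃o CTreeStar M, IsBot (e' x) := fun e' y => by
      simpa using e'.monotone (h (e'.symm y))
    exact le_antisymm (hbot _ _) (hbot _ _)
  · rw [OrderIso.map_inf, OrderIso.map_inf, hleaf, hleaf]

end CTreeStar

/-! ### Finiteness of `Θ` -/

namespace CTreeStar

variable {M : Type u} [CSet M]

theorem lt_inf_of_le {c x y z : CTreeStar M} (hx : c < x) (hy : c < y) (hxz : x ≤ z) (hyz : y ≤ z) :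
    c < x ⊓ y := by
  rcases le_total_of_le hxz hyz with h | h
  · rwa [inf_eq_left.2 h]
  · rwa [inf_eq_right.2 h]

theorem mem_treeCone {a y t : CTreeStar M} : t ∈ treeCone a y ↔ a < t ⊓ y :=
  ⟨fun ⟨_, h1, h2, h3⟩ => h1.trans_le (le_inf h2 h3),
    fun h => ⟨_, h, inf_le_left, inf_le_right⟩⟩

/-- `a < x ⊓ y` means that `x` and `y` lie in the same cone at `a`; this is transitivity of that
relation. -/
theorem lt_inf_trans {a x y z : CTreeStar M} (h1 : a < x ⊓ y) (h2 : a < y ⊓ z) : a < x ⊓ z :=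
  (lt_inf_of_le h1 h2 inf_le_right inf_le_left).trans_le
    (inf_le_inf inf_le_left inf_le_right)

/-- Ultrametric principle: `x` is still with `y` when `z` leaves `y`, so `z` leaves `x` at the same
point. -/
theorem inf_eq_of_lt {x y z : CTreeStar M} (h : z ⊓ y < x ⊓ y) : x ⊓ z = z ⊓ y := by
  refine le_antisymm ?_ (le_inf (h.le.trans inf_le_left) inf_le_left)
  have h1 : z ⊓ y ≤ x ⊓ z := le_inf (h.le.trans inf_le_left) inf_le_left
  by_contra h2
  have h3 := lt_inf_of_le (h1.lt_of_not_ge h2) h inf_le_left inf_le_left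
  exact h3.not_ge (le_inf (inf_le_left.trans inf_le_right) (inf_le_right.trans inf_le_right))

theorem mem_offBranch {c : CTreeStar M} {γ : M} :
    γ ∈ offBranch c ↔ c ≤ leaf γ ∧ ∀ x ∈ Theta1 M, c < x → ¬ c < leaf γ ⊓ x := by
  simp only [offBranch, mem_ofPred_eq, mem_treeCone]

theorem mem_theta1_of_le {x y : CTreeStar M} (hy : y ∈ Theta1 M) (h : x ≤ y) : x ∈ Theta1 M :=
  let ⟨α, β, h1, h2, h3⟩ := hy
  ⟨α, β, h1, h.trans h2, h.trans h3⟩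

/-- Instances of `C` where the variable is repeated are settled by irreflexivity and by `α, β ∉ F`;
the two hypotheses treat single occurrences. -/
theorem agreesOver_of_forall {F : Set M} {α β : M} (hα : α ∉ F) (hβ : β ∉ F)
    (h1 : ∀ f ∈ F, ∀ f' ∈ F, leaf f ⊓ leaf f' ≤ leaf α ↔ leaf f ⊓ leaf f' ≤ leaf β)
    (h2 : ∀ f ∈ F, ∀ f' ∈ F, leaf α ⊓ leaf f' ≤ leaf f ↔ leaf β ⊓ leaf f' ≤ leaf f) :
    AgreesOver F α β := by
  have hsw : ∀ x z : M, ¬ CSet.C x z x := fun x z h => CSet.irrefl _ _ (CSet.c_swap _ _ _ h)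
  have hne : ∀ γ, γ ∉ F → ∀ f : F, CSet.C (f : M) γ γ := fun γ hγ f =>
    CSet.c_ne _ _ fun h => hγ (h ▸ f.2)
  rintro (_ | f) (_ | f') (_ | f'') <;> simp only [Option.elim]
  · simp [CSet.irrefl]
  · simp [CSet.irrefl]
  · simp [hsw]
  · rw [C_iff, C_iff, h1 f' f'.2 f'' f''.2]
  · simp [hne α hα, hne β hβ]
  · rw [C_iff, C_iff, h2 f f.2 f'' f''.2]
  · rw [C_iff, C_iff, inf_comm (leaf (f' : M)), inf_comm (leaf (f' : M)), h2 f f.2 f' f'.2]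

theorem mem_thetaU_of_maximal {c : CTreeStar M} (hc : c ∈ Theta1 M)
    (hmax : ∀ x ∈ Theta1 M, ¬ c < x) : c ∈ ThetaU M := by
  refine ⟨{y | y ≤ c}, ⟨c, le_refl c⟩, ⟨⟨fun y hy => mem_theta1_of_le hc hy, ?_⟩, ?_⟩, ?_⟩
  · intro x hx y hy _
    exact le_total_of_le hx hy
  · intro K hK hcK y hy
    by_contra hyc
    have := (hK.2.total hy (hcK (show c ≤ c from le_rfl))).resolve_left hyc
    exact hmax y (hK.1 hy) (this.lt_of_not_ge hyc)
  · exact ⟨fun y hy => hy, fun z hz => hz (show c ≤ c from le_rfl)⟩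

theorem theta_subset {x : CTreeStar M} (hx : x ∈ ThetaB M ∪ ThetaS M ∪ ThetaI M) :
    x ∈ Theta1 M := by
  rcases hx with (hx | hx) | hx
  · exact hx.1
  · exact hx.1.1
  · exact hx.1.1

/-- `Θ` is closed under meets. -/
theorem inf_mem_theta {u v : CTreeStar M} (hu : u ∈ Theta M) (hv : v ∈ Theta M) :
    u ⊓ v ∈ Theta M := by
  by_cases huv : u ≤ v
  · rwa [inf_eq_left.2 huv]
  by_cases hvu : v ≤ u
  · rwa [inf_eq_right.2 hvu]
  -- A supremum in `U` may lie outside `Θ₁`; it is replaced by a point of its branch high enough not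
  -- to be below the other node. The meet is unchanged and is a branching point of `Θ₁`.
  have key : ∀ {u v : CTreeStar M}, u ∈ Theta M → ¬ u ≤ v → ∃ k ∈ Theta1 M, k ≤ u ∧ ¬ k ≤ v := by
    intro u v hu huv
    rw [Theta, union_assoc, union_assoc, ← union_assoc (ThetaB M)] at hu
    rcases hu with ⟨K, -, hK, hu⟩ | hu
    · by_contra! h
      exact huv (hu.2 fun k hk => h k (hK.1.1 hk) (hu.1 hk))
    · exact ⟨u, theta_subset hu, le_rfl, huv⟩
  obtain ⟨k, hk, hku, hkv⟩ := key hu huv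
  obtain ⟨l, hl, hlv, hlu⟩ := key hv hvu
  have h1 : u ⊓ v ≤ k := (le_total_of_le hku inf_le_left).resolve_left
    fun h => hkv (h.trans inf_le_right)
  have h2 : u ⊓ v ≤ l := (le_total_of_le hlv inf_le_right).resolve_left
    fun h => hlu (h.trans inf_le_left)
  have hB : u ⊓ v ∈ ThetaB M := by
    refine ⟨mem_theta1_of_le hk h1, k, hk, l, hl, fun h => hkv (h.trans hlv),
      fun h => hlu (h.trans hku), ?_⟩
    have : u ⊓ v = k ⊓ l := le_antisymm (le_inf h1 h2) (inf_le_inf hku hlv)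
    rw [this]
    exact isGLB_pair
  exact Or.inl (Or.inl (Or.inr hB))

theorem _root_.Set.Finite.exists_forall_le_of_isChain {P : Type*} [PartialOrder P] {s : Set P}
    (hs : s.Finite) (hne : s.Nonempty) (hc : IsChain (· ≤ ·) s) : ∃ m ∈ s, ∀ x ∈ s, x ≤ m := by
  obtain ⟨m, hm⟩ := hs.exists_maximal hne
  exact ⟨m, hm.1, fun x hx => (hc.total hx hm.1).elim id fun h => hm.2 hx h⟩

theorem _root_.Set.Finite.exists_forall_ge_of_isChain {P : Type*} [PartialOrder P] {s : Set P}
    (hs : s.Finite) (hne : s.Nonempty) (hc : IsChain (· ≤ ·) s) : ∃ m ∈ s, ∀ x ∈ s, m ≤ x := by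
  obtain ⟨m, hm⟩ := hs.exists_minimal hne
  exact ⟨m, hm.1, fun x hx => (hc.total hm.1 hx).elim id fun h => hm.2 hx h⟩

theorem isChain_of_le {s : Set (CTreeStar M)} {a : CTreeStar M} (h : ∀ x ∈ s, x ≤ a) :
    IsChain (· ≤ ·) s := fun x hx y hy _ => le_total_of_le (h x hx) (h y hy)

section Finite

variable {F : Set M}

/-- If no leaf of `F` were above `x`, all elements above `x` would have the same meets with `F`,
hence the same type. -/
theorem exists_le_leaf_of_mem_theta1 (hF : ∀ x y, AgreesOver F x y → SameType x y)
    {x : CTreeStar M} (hx : x ∈ Theta1 M) : ∃ f ∈ F, x ≤ leaf f := by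
  by_contra! hcon
  obtain ⟨α, β, hαβ, hα, hβ⟩ := hx
  have key : ∀ α β, x ≤ leaf α → x ≤ leaf β → ∀ f ∈ F, leaf α ⊓ leaf f ≤ leaf β := by
    intro α β hα hβ f hf
    refine (le_total_of_le hα inf_le_left).elim (fun h => ?_) fun h => h.trans hβ
    exact absurd (h.trans inf_le_right) (hcon f hf)
  refine hαβ (hF _ _ (agreesOver_of_forall (fun h => hcon α h hα) (fun h => hcon β h hβ) ?_ ?_))
  · exact fun f hf f' _ =>
      ⟨fun h => (le_inf h inf_le_left).trans (key α β hα hβ f hf),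
        fun h => (le_inf h inf_le_left).trans (key β α hβ hα f hf)⟩
  · intro f _ f' hf'
    have : leaf α ⊓ leaf f' = leaf β ⊓ leaf f' :=
      le_antisymm (le_inf (key α β hα hβ f' hf') inf_le_right)
        (le_inf (key β α hβ hα f' hf') inf_le_right)
    rw [this]

/-- The nodes of the tree spanned by a set of leaves. -/
def spannedNodes (F : Set M) : Set (CTreeStar M) :=
  image2 (fun f f' => leaf f ⊓ leaf f') F F

/-- Moving the point where an element leaves the branch of `a` does not change its `C`-relations to
`F` as long as no node spanned by `F` is met. -/
theorem agreesOver_of_gap {c c' : CTreeStar M} {a γ γ' : M} (ha : a ∈ F) (hcc' : c ≤ c')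
    (hgap : ∀ e ∈ spannedNodes F, c ≤ e → ¬ e ≤ c') (hγ : leaf γ ⊓ leaf a = c)
    (hγ' : leaf γ' ⊓ leaf a = c') : AgreesOver F γ γ' := by
  have hE : ∀ f ∈ F, ∀ f' ∈ F, leaf f ⊓ leaf f' ∈ spannedNodes F := fun f hf f' hf' =>
    mem_image2_of_mem hf hf'
  have hca : c ≤ leaf a := hγ ▸ inf_le_right
  have hc'a : c' ≤ leaf a := hγ' ▸ inf_le_right
  -- By the gap, `f` leaves the branch of `a` either below `c`, and then `γ` and `γ'` have the same
  -- meet with `f`, or above `c'`, and then these meets are `c` and `c'`.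
  have cases : ∀ f ∈ F, leaf γ ⊓ leaf f = leaf γ' ⊓ leaf f ∨
      (c' < leaf f ⊓ leaf a ∧ leaf γ ⊓ leaf f = c ∧ leaf γ' ⊓ leaf f = c') := by
    intro f hf
    have he := hgap _ (hE f hf a ha)
    rcases le_total_of_le hca (inf_le_right : leaf f ⊓ leaf a ≤ leaf a) with h | h
    · have h' : c' < leaf f ⊓ leaf a :=
        ((le_total_of_le hc'a inf_le_right).resolve_right (he h)).lt_of_not_ge (he h)
      refine Or.inr ⟨h', ?_, ?_⟩
      · rw [inf_comm, ← hγ]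
        exact inf_eq_of_lt (by rw [hγ]; exact hcc'.trans_lt h')
      · rw [inf_comm, ← hγ']
        exact inf_eq_of_lt (by rw [hγ']; exact h')
    · have h' : leaf f ⊓ leaf a < c := h.lt_of_not_ge fun hc => he hc (h.trans hcc')
      left
      exact (inf_eq_of_lt (by rw [hγ]; exact h')).trans
        (inf_eq_of_lt (by rw [hγ']; exact h'.trans_le hcc')).symm
  refine agreesOver_of_forall (fun h => ?_) (fun h => ?_) ?_ ?_
  · exact hgap c (hγ ▸ hE γ h a ha) le_rfl hcc'
  · exact hgap c' (hγ' ▸ hE γ' h a ha) hcc' le_rfl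
  · intro f hf f' hf'
    have key : ∀ γ, leaf f ⊓ leaf f' ≤ leaf γ ↔ leaf f ⊓ leaf f' ≤ leaf γ ⊓ leaf f := fun γ =>
      ⟨fun h => le_inf h inf_le_left, fun h => h.trans inf_le_left⟩
    rw [key γ, key γ']
    rcases cases f hf with h | ⟨-, h1, h2⟩
    · rw [h]
    · rw [h1, h2]
      refine ⟨fun h => h.trans hcc', fun h => ?_⟩
      exact (le_total_of_le (h.trans hc'a) hca).resolve_right
        fun h' => hgap _ (hE f hf f' hf') h' h
  · intro f hf f' hf'
    rcases cases f' hf' with h | ⟨-, h1, h2⟩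
    · rw [h]
    · rw [h1, h2]
      refine ⟨fun h => ?_, fun h => hcc'.trans h⟩
      have := hgap _ (hE f hf a ha) (le_inf h hca)
      exact ((le_total_of_le hc'a inf_le_right).resolve_right this).trans inf_le_left

theorem finite_spannedNodes (hFin : F.Finite) : (spannedNodes F).Finite := hFin.image2 _ hFin

theorem thetaB_subset (hF : ∀ x y, AgreesOver F x y → SameType x y) :
    ThetaB M ⊆ spannedNodes F := by
  rintro b ⟨-, x, hx, y, hy, hxy, hyx, hb⟩
  obtain ⟨f, hf, hxf⟩ := exists_le_leaf_of_mem_theta1 hF hx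
  obtain ⟨f', hf', hyf⟩ := exists_le_leaf_of_mem_theta1 hF hy
  refine ⟨f, hf, f', hf', ?_⟩
  rw [hb.unique isGLB_pair]
  refine le_antisymm (le_inf ?_ ?_) (inf_le_inf hxf hyf)
  · exact (le_total_of_le hxf inf_le_left).resolve_left fun h =>
      (le_total_of_le (h.trans inf_le_right) hyf).elim hxy hyx
  · exact (le_total_of_le hyf inf_le_right).resolve_left fun h =>
      (le_total_of_le (h.trans inf_le_left) hxf).elim hyx hxy

/-- If for every `f ∈ F` some element of `K` were not below `f`, the largest of these finitely many
elements would still be below some leaf of `F`, a contradiction. Maximality of `K` gives equality.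
-/
theorem exists_eq_of_isBranchOf (hFin : F.Finite)
    (hF : ∀ x y, AgreesOver F x y → SameType x y) {K : Set (CTreeStar M)}
    (hK : IsBranchOf (Theta1 M) K) (hne : K.Nonempty) :
    ∃ f ∈ F, K = {x | x ∈ Theta1 M ∧ x ≤ leaf f} := by
  obtain ⟨f, hf, hKf⟩ : ∃ f ∈ F, ∀ k ∈ K, k ≤ leaf f := by
    by_contra! h
    obtain ⟨k₀, hk₀⟩ := hne
    have : Nonempty (CTreeStar M) := ⟨k₀⟩
    choose! k hk hkf using h
    obtain ⟨f₀, hf₀, -⟩ := exists_le_leaf_of_mem_theta1 hF (hK.1.1 hk₀)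
    obtain ⟨m, ⟨f₁, hf₁, hm⟩, hmax⟩ := (hFin.image k).exists_forall_le_of_isChain
      ⟨_, f₀, hf₀, rfl⟩ (hK.1.2.mono (image_subset_iff.2 fun f hf => hk f hf))
    subst hm
    obtain ⟨f, hf, hle⟩ := exists_le_leaf_of_mem_theta1 hF (hK.1.1 (hk f₁ hf₁))
    exact hkf f hf ((hmax _ ⟨f, hf, rfl⟩).trans hle)
  refine ⟨f, hf, hK.eq_of_subset ⟨fun x hx => hx.1, isChain_of_le fun x hx => hx.2⟩
    fun k hk => ⟨hK.1.1 hk, hKf k hk⟩⟩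

theorem finite_thetaU (hFin : F.Finite) (hF : ∀ x y, AgreesOver F x y → SameType x y) :
    (ThetaU M).Finite := by
  refine (hFin.biUnion fun f _ => (?_ :
    {u | IsLUB {x | x ∈ Theta1 M ∧ x ≤ leaf f} u}.Finite)).subset ?_
  · exact Set.Subsingleton.finite fun u hu v hv => hu.unique hv
  · rintro u ⟨K, hne, hK, hu⟩
    obtain ⟨f, hf, rfl⟩ := exists_eq_of_isBranchOf hFin hF hK hne
    exact mem_biUnion hf hu

/-- The points outside of which the branches of `Θ₁` are homogeneous. -/
def exceptionalPoints (F : Set M) : Set (CTreeStar M) :=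
  spannedNodes F ∪ ThetaU M ∪ {x | IsBot x}

theorem finite_exceptionalPoints (hFin : F.Finite)
    (hF : ∀ x y, AgreesOver F x y → SameType x y) : (exceptionalPoints F).Finite :=
  ((finite_spannedNodes hFin).union (finite_thetaU hFin hF)).union
    (Set.Subsingleton.finite fun _ hx _ hy => le_antisymm (hx _) (hy _))

/-- As `c` is not spanned by `F`, all leaves of `F` above `c`, hence all points of `Θ₁` above `c`,
lie in the cone of `a` at `c`. Such points exist because `c ∉ U`. -/
theorem offBranch_eq (hF : ∀ x y, AgreesOver F x y → SameType x y) {c : CTreeStar M} {a : M}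
    (hc : c ∈ Theta1 M) (hcE : c ∉ exceptionalPoints F) (ha : a ∈ F) (hca : c ≤ leaf a) :
    offBranch c = {γ | leaf γ ⊓ leaf a = c} := by
  have hspan : ∀ f ∈ F, c ≤ leaf f → c < leaf f ⊓ leaf a := fun f hf h =>
    lt_of_le_of_ne (le_inf h hca) fun h' => hcE (Or.inl (Or.inl ⟨f, hf, a, ha, h'.symm⟩))
  ext γ
  rw [mem_offBranch]
  constructor
  · rintro ⟨hγ, hoff⟩
    by_contra hne
    have hlt : c < leaf γ ⊓ leaf a := lt_of_le_of_ne (le_inf hγ hca) (Ne.symm hne)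
    obtain ⟨x, hx, hcx⟩ : ∃ x ∈ Theta1 M, c < x := by
      by_contra! h
      exact hcE (Or.inl (Or.inr (mem_thetaU_of_maximal hc h)))
    obtain ⟨f, hf, hxf⟩ := exists_le_leaf_of_mem_theta1 hF hx
    refine hoff x hx hcx (lt_inf_trans hlt ?_)
    refine lt_inf_trans (y := leaf f) ?_ ?_
    · rw [inf_comm]
      exact hspan f hf (hcx.le.trans hxf)
    · rwa [inf_eq_right.2 hxf]
  · intro hγ
    have hγ' : leaf γ ⊓ leaf a = c := hγ
    refine ⟨hγ' ▸ inf_le_left, fun x hx hcx hlt => ?_⟩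
    obtain ⟨f, hf, hxf⟩ := exists_le_leaf_of_mem_theta1 hF hx
    have h1 := lt_inf_trans (hlt.trans_le (inf_le_inf_left _ hxf)) (hspan f hf (hcx.le.trans hxf))
    exact h1.ne' hγ'

/-- Not being the bottom, `c` is a meet of two leaves, and these cannot both lie in the cone of `a`
at `c`. -/
theorem offBranch_nonempty (hF : ∀ x y, AgreesOver F x y → SameType x y) {c : CTreeStar M}
    {a : M} (hc : c ∈ Theta1 M) (hcE : c ∉ exceptionalPoints F) (ha : a ∈ F) (hca : c ≤ leaf a) :
    (offBranch c).Nonempty := by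
  rw [offBranch_eq hF hc hcE ha hca]
  rcases isBot_or_eq_inf c with h | ⟨β, γ, rfl⟩
  · exact absurd (Or.inr h) hcE
  by_contra hemp
  rw [not_nonempty_iff_eq_empty, eq_empty_iff_forall_notMem] at hemp
  have h1 := lt_of_le_of_ne (le_inf inf_le_left hca) (Ne.symm (hemp β))
  have h2 := lt_of_le_of_ne (le_inf inf_le_right hca) (Ne.symm (hemp γ))
  rw [inf_comm (leaf γ) (leaf a)] at h2
  exact (lt_inf_trans h1 h2).ne rfl

/-- By `agreesOver_of_gap` with `c = c'`, all elements leaving the branch at a non-exceptional point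
have the same type. -/
theorem thetaS_subset (hF : ∀ x y, AgreesOver F x y → SameType x y) :
    ThetaS M ⊆ exceptionalPoints F := by
  rintro c ⟨⟨hc, -⟩, α, hα, β, hβ, hαβ⟩
  by_contra hcE
  obtain ⟨a, ha, hca⟩ := exists_le_leaf_of_mem_theta1 hF hc
  rw [offBranch_eq hF hc hcE ha hca] at hα hβ
  refine hαβ (hF _ _ (agreesOver_of_gap ha le_rfl (fun e he h1 h2 => hcE ?_) hα hβ))
  exact Or.inl (Or.inl (le_antisymm h1 h2 ▸ he))

/-- Between consecutive exceptional points of a branch the departing type is constant, so a maximal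
uniform interval can only begin at an exceptional point or just above one. -/
theorem exists_covBy_of_mem_thetaI (hFin : F.Finite)
    (hF : ∀ x y, AgreesOver F x y → SameType x y) {x : CTreeStar M} (hx : x ∈ ThetaI M)
    (hxE : x ∉ exceptionalPoints F) : ∃ e ∈ exceptionalPoints F, ∃ a ∈ F, e ⋖ x ∧ x ≤ leaf a := by
  obtain ⟨⟨hx1, -⟩, α, K, J, hK, ⟨y₁, hy₁⟩, hJ, hxJ⟩ := hx
  have hEfin := finite_exceptionalPoints hFin hF
  obtain ⟨a, ha, rfl⟩ := exists_eq_of_isBranchOf hFin hF hK ⟨y₁, hJ.1.1.1 hy₁⟩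
  have hJa : ∀ y ∈ J, y ≤ leaf a := fun y hy => (hJ.1.1.1 hy).2
  have hxa : x ≤ leaf a := (hxJ.1 hy₁).trans (hJa _ hy₁)
  -- The stretch of the branch of `a` that no exceptional point separates from `x`.
  let J₀ : Set (CTreeStar M) := {y | (y ∈ Theta1 M ∧ y ≤ leaf a) ∧
    ∀ e ∈ exceptionalPoints F, (x ≤ e → ¬ e ≤ y) ∧ (y ≤ e → ¬ e ≤ x)}
  have hint : ∀ y ∈ J₀, ∀ y' ∈ J₀, ∀ z, z ∈ Theta1 M ∧ z ≤ leaf a → y ≤ z → z ≤ y' → z ∈ J₀ :=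
    fun y hy y' hy' z hz h1 h2 => ⟨hz, fun e he =>
      ⟨fun h3 h4 => (hy'.2 e he).1 h3 (h4.trans h2), fun h3 => (hy.2 e he).2 (h1.trans h3)⟩⟩
  have hJ₀E : ∀ y ∈ J₀, y ∉ exceptionalPoints F := fun y hy hyE =>
    (le_total_of_le hxa hy.1.2).elim (fun h => (hy.2 y hyE).1 h le_rfl)
      fun h => (hy.2 y hyE).2 le_rfl h
  have hxJ₀ : x ∈ J₀ := ⟨⟨hx1, hxa⟩, fun e he =>
    ⟨fun h1 h2 => hxE (le_antisymm h1 h2 ▸ he), fun h1 h2 => hxE (le_antisymm h1 h2 ▸ he)⟩⟩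
  -- Otherwise an exceptional point lies between `x` and each element of `J`. The least exceptional
  -- point above `x` on the branch is then a lower bound of `J`, so it equals the infimum `x`.
  obtain ⟨y₀, hy₀, hy₀'⟩ : ∃ y ∈ J, y ∈ J₀ := by
    by_contra! h
    have hbet : ∀ y ∈ J, ∃ e ∈ exceptionalPoints F, x ≤ e ∧ e ≤ y := by
      intro y hy
      by_contra! h'
      refine h y hy ⟨hJ.1.1.1 hy, fun e he => ⟨fun h1 h2 => h' e he h1 h2, fun h1 h2 => ?_⟩⟩
      have : e = x := le_antisymm h2 ((hxJ.1 hy).trans h1)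
      exact hxE (this ▸ he)
    obtain ⟨e₁, he₁, hxe₁, hey₁⟩ := hbet y₁ hy₁
    obtain ⟨m, ⟨hm, hxm, -⟩, hmin⟩ :=
      (hEfin.subset (fun e (he : e ∈ exceptionalPoints F ∧ x ≤ e ∧ e ≤ leaf a) => he.1) :
        {e | e ∈ exceptionalPoints F ∧ x ≤ e ∧ e ≤ leaf a}.Finite).exists_forall_ge_of_isChain
        ⟨e₁, he₁, hxe₁, hey₁.trans (hJa _ hy₁)⟩ (isChain_of_le fun e he => he.2.2)
    have : m ≤ x := hxJ.2 fun y hy => by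
      obtain ⟨e, he, hxe, hey⟩ := hbet y hy
      exact (hmin e ⟨he, hxe, hey.trans (hJa _ hy)⟩).trans hey
    exact hxE (le_antisymm hxm this ▸ hm)
  have hunif : J₀ ⊆ uniformPoints α := by
    intro y hy
    have hyE := hJ₀E y hy
    refine ⟨⟨hy.1.1, ?_⟩, ?_⟩
    · rintro ((h | h) | h)
      · exact hyE (Or.inl (Or.inr h))
      · exact hyE (Or.inl (Or.inl (thetaB_subset hF h)))
      · exact hyE (thetaS_subset hF h)
    · intro γ hγ
      have hy₀E := hJ₀E y₀ hy₀'
      obtain ⟨γ₀, hγ₀⟩ := offBranch_nonempty hF hy₀'.1.1 hy₀E ha hy₀'.1.2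
      have hα : SameType α γ₀ := (hJ.1.2 hy₀).2 hγ₀
      rw [offBranch_eq hF hy₀'.1.1 hy₀E ha hy₀'.1.2] at hγ₀
      rw [offBranch_eq hF hy.1.1 hyE ha hy.1.2] at hγ
      have hgap : ∀ z ∈ J₀, ∀ z' ∈ J₀, ∀ e ∈ spannedNodes F, z ≤ e → ¬ e ≤ z' :=
        fun z hz z' hz' e he h1 h2 => hJ₀E e (hint z hz z' hz' e
          ⟨mem_theta1_of_le hz'.1.1 h2, h2.trans hz'.1.2⟩ h1 h2) (Or.inl (Or.inl he))
      have hag : AgreesOver F γ₀ γ := (le_total_of_le hy₀'.1.2 hy.1.2).elim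
        (fun h => agreesOver_of_gap ha h (hgap _ hy₀' _ hy) hγ₀ hγ)
        fun h => (agreesOver_of_gap ha h (hgap _ hy _ hy₀') hγ hγ₀).symm
      exact fun φ => (hα φ).trans (hF _ _ hag φ)
  -- `J` and `J₀` share `y₀`, so their union is again a uniform interval and `J` is maximal.
  have hsub : J₀ ⊆ J := by
    refine subset_union_right.trans (hJ.2 (y := J ∪ J₀) ⟨⟨?_, ?_⟩, ?_⟩ subset_union_left)
    · exact union_subset hJ.1.1.1 fun y hy => hy.1
    · intro y hy y' hy' z hz h1 h2
      rcases hy with hy | hy <;> rcases hy' with hy' | hy'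
      · exact Or.inl (hJ.1.1.2 y hy y' hy' z hz h1 h2)
      · exact (le_total_of_le hz.2 hy₀'.1.2).elim
          (fun h => Or.inl (hJ.1.1.2 y hy y₀ hy₀ z hz h1 h))
          fun h => Or.inr (hint y₀ hy₀' y' hy' z hz h h2)
      · exact (le_total_of_le hz.2 hy₀'.1.2).elim
          (fun h => Or.inr (hint y hy y₀ hy₀' z hz h1 h))
          fun h => Or.inl (hJ.1.1.2 y₀ hy₀ y' hy' z hz h h2)
      · exact Or.inr (hint y hy y' hy' z hz h1 h2)
    · exact union_subset hJ.1.2 hunif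
  -- As `x` bounds `J₀` from below, `J₀` has no point strictly below `x`.
  have hmem : ∀ y, y ≤ x → (∀ e ∈ exceptionalPoints F, y ≤ e → ¬ e < x) → x ≤ y := by
    intro y hyx hy
    refine hxJ.1 (hsub ⟨⟨mem_theta1_of_le hx1 hyx, hyx.trans hxa⟩, fun e he => ⟨fun h1 h2 => ?_,
      fun h1 h2 => ?_⟩⟩)
    · exact hxE (le_antisymm h1 (h2.trans hyx) ▸ he)
    · exact hy e he h1 (lt_of_le_of_ne h2 fun h => hxE (h ▸ he))
  -- With no exceptional point below it, `x` would be the bottom, which is exceptional.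
  have hne : {e | e ∈ exceptionalPoints F ∧ e < x}.Nonempty := by
    by_contra hemp
    rw [not_nonempty_iff_eq_empty, eq_empty_iff_forall_notMem] at hemp
    exact hxE (Or.inr fun y => (hmem (x ⊓ y) inf_le_left
      fun e he _ h => hemp e ⟨he, h⟩).trans inf_le_right)
  obtain ⟨e, ⟨he, hex⟩, hmax⟩ := (hEfin.subset fun e he => he.1).exists_forall_le_of_isChain hne
    (isChain_of_le fun e he => he.2.le)
  refine ⟨e, he, a, ha, ⟨hex, fun y hey hyx => ?_⟩, hxa⟩
  exact hyx.not_ge (hmem y hyx.le fun e' he' h1 h2 => hey.not_ge (h1.trans (hmax e' ⟨he', h2⟩)))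

/-- For given `e` and `a`, at most one point on the branch of `a` covers `e`, so the non-exceptional
points of `I` are finite in number. -/
theorem finite_theta_of_agreesOver (hFin : F.Finite)
    (hF : ∀ x y, AgreesOver F x y → SameType x y) : (Theta M).Finite := by
  have hE := finite_exceptionalPoints hFin hF
  have hI : (⋃ e ∈ exceptionalPoints F, ⋃ a ∈ F, {x | e ⋖ x ∧ x ≤ leaf a}).Finite := by
    refine hE.biUnion fun e _ => hFin.biUnion fun a _ => Set.Subsingleton.finite ?_
    rintro x ⟨hx, hxa⟩ y ⟨hy, hya⟩
    rcases le_total_of_le hxa hya with h | h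
    · exact h.eq_of_not_lt fun h' => hy.2 hx.1 h'
    · exact (h.eq_of_not_lt fun h' => hx.2 hy.1 h').symm
  refine (hE.union hI).subset ?_
  rintro x (((hx | hx) | hx) | hx)
  · exact Or.inl (Or.inl (Or.inr hx))
  · exact Or.inl (Or.inl (Or.inl (thetaB_subset hF hx)))
  · exact Or.inl (thetaS_subset hF hx)
  · by_cases hxE : x ∈ exceptionalPoints F
    · exact Or.inl hxE
    · obtain ⟨e, he, a, ha, h1, h2⟩ := exists_covBy_of_mem_thetaI hFin hF hx hxE
      exact Or.inr (mem_biUnion he (mem_biUnion ha ⟨h1, h2⟩))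

end Finite

end CTreeStar

/-! ### Invariance of `Θ` under automorphisms -/

section OrderIso

variable {P : Type*} [PartialOrder P]

theorem _root_.IsBranchOf.image {S K : Set P} (h : IsBranchOf S K) (e : P ≃o P) :
    IsBranchOf (e '' S) (e '' K) := by
  refine ⟨⟨image_mono h.1.1, ?_⟩, ?_⟩
  · rintro _ ⟨x, hx, rfl⟩ _ ⟨y, hy, rfl⟩ -
    simpa using h.1.2.total hx hy
  · rintro K' ⟨hK', hc⟩ hKK'
    have h1 : e.symm '' K' ⊆ K := by
      refine h.2 ⟨?_, ?_⟩ ?_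
      · rintro _ ⟨x, hx, rfl⟩
        obtain ⟨y, hy, rfl⟩ := hK' hx
        simpa using hy
      · rintro _ ⟨x, hx, rfl⟩ _ ⟨y, hy, rfl⟩ -
        simpa using hc.total hx hy
      · exact fun x hx => ⟨e x, hKK' ⟨x, hx, rfl⟩, by simp⟩
    exact fun x hx => ⟨e.symm x, h1 ⟨x, hx, rfl⟩, by simp⟩

theorem _root_.IsIntervalOf.image {K J : Set P} (h : IsIntervalOf K J) (e : P ≃o P) :
    IsIntervalOf (e '' K) (e '' J) := by
  refine ⟨image_mono h.1, ?_⟩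
  rintro _ ⟨x, hx, rfl⟩ _ ⟨y, hy, rfl⟩ _ ⟨z, hz, rfl⟩ h1 h2
  exact ⟨z, h.2 x hx y hy z hz (e.le_iff_le.1 h1) (e.le_iff_le.1 h2), rfl⟩

end OrderIso

namespace CTreeStar

variable {M : Type u} [CSet M]

theorem sameType_apply (g : CAut M) (α : M) : SameType α (g α) := fun φ =>
  (StrongHomClass.realize_formula g φ (v := fun _ => α)).symm

theorem sameType_apply_iff (g : CAut M) (α β : M) : SameType (g α) (g β) ↔ SameType α β :=
  ⟨fun h φ => (sameType_apply g α φ).trans ((h φ).trans (sameType_apply g β φ).symm),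
    fun h φ => (sameType_apply g α φ).symm.trans ((h φ).trans (sameType_apply g β φ))⟩

theorem treeIso_symm_treeIso (g : CAut M) (x : CTreeStar M) :
    treeIso (g.symm : CAut M) (treeIso g x) = x := (treeIso g).symm_apply_apply x

theorem treeIso_mem_iff {S : Set (CTreeStar M)} (h : ∀ (g : CAut M), ∀ x ∈ S, treeIso g x ∈ S)
    (g : CAut M) (x : CTreeStar M) : treeIso g x ∈ S ↔ x ∈ S :=
  ⟨fun hx => by simpa only [treeIso_symm_treeIso] using h g.symm _ hx, h g x⟩

theorem treeIso_image_eq {S : Set (CTreeStar M)} (h : ∀ (g : CAut M), ∀ x ∈ S, treeIso g x ∈ S)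
    (g : CAut M) : treeIso g '' S = S := by
  refine (image_subset_iff.2 (h g)).antisymm fun x hx => ⟨(treeIso g).symm x, ?_, by simp⟩
  exact h g.symm x hx

theorem treeIso_mem_theta1 (g : CAut M) (x : CTreeStar M) (hx : x ∈ Theta1 M) :
    treeIso g x ∈ Theta1 M := by
  obtain ⟨α, β, h1, h2, h3⟩ := hx
  exact ⟨g α, g β, by rwa [sameType_apply_iff], (treeIso g).monotone h2, (treeIso g).monotone h3⟩

theorem isBranchOf_theta1_image (g : CAut M) {K : Set (CTreeStar M)}
    (hK : IsBranchOf (Theta1 M) K) : IsBranchOf (Theta1 M) (treeIso g '' K) := by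
  have := hK.image (treeIso g)
  rwa [treeIso_image_eq treeIso_mem_theta1] at this

theorem treeIso_mem_thetaU (g : CAut M) (x : CTreeStar M) (hx : x ∈ ThetaU M) :
    treeIso g x ∈ ThetaU M := by
  obtain ⟨K, hne, hK, hx⟩ := hx
  exact ⟨_, hne.image _, isBranchOf_theta1_image g hK, (treeIso g).isLUB_image'.2 hx⟩

theorem treeIso_mem_thetaB (g : CAut M) (b : CTreeStar M) (hb : b ∈ ThetaB M) :
    treeIso g b ∈ ThetaB M := by
  obtain ⟨h, x, hx, y, hy, hxy, hyx, hb⟩ := hb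
  refine ⟨treeIso_mem_theta1 g b h, _, treeIso_mem_theta1 g x hx, _, treeIso_mem_theta1 g y hy,
    by simpa, by simpa, ?_⟩
  rw [← image_pair]
  exact (treeIso g).isGLB_image'.2 hb

theorem apply_mem_offBranch (g : CAut M) {c : CTreeStar M} {γ : M} (h : γ ∈ offBranch c) :
    g γ ∈ offBranch (treeIso g c) := by
  rw [mem_offBranch] at h ⊢
  refine ⟨(treeIso g).monotone h.1, fun x hx hcx => ?_⟩
  obtain ⟨x, rfl⟩ := (treeIso g).surjective x
  rw [← treeIso_leaf, ← OrderIso.map_inf, OrderIso.lt_iff_lt]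
  exact h.2 x ((treeIso_mem_iff treeIso_mem_theta1 g x).1 hx) ((treeIso g).lt_iff_lt.1 hcx)

theorem treeIso_mem_thetaS (g : CAut M) (c : CTreeStar M) (hc : c ∈ ThetaS M) :
    treeIso g c ∈ ThetaS M := by
  obtain ⟨⟨h1, h2⟩, α, hα, β, hβ, h⟩ := hc
  refine ⟨⟨treeIso_mem_theta1 g c h1, fun h' => h2 ?_⟩, g α, apply_mem_offBranch g hα, g β,
    apply_mem_offBranch g hβ, by rwa [sameType_apply_iff]⟩
  exact h'.imp (treeIso_mem_iff treeIso_mem_thetaU g c).1 (treeIso_mem_iff treeIso_mem_thetaB g c).1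

theorem treeIso_mem_theta1_diff (g : CAut M) (c : CTreeStar M)
    (hc : c ∈ Theta1 M \ (ThetaU M ∪ ThetaB M ∪ ThetaS M)) :
    treeIso g c ∈ Theta1 M \ (ThetaU M ∪ ThetaB M ∪ ThetaS M) :=
  ⟨treeIso_mem_theta1 g c hc.1, fun h' => hc.2 (h'.imp
    (Or.imp (treeIso_mem_iff treeIso_mem_thetaU g c).1 (treeIso_mem_iff treeIso_mem_thetaB g c).1)
    (treeIso_mem_iff treeIso_mem_thetaS g c).1)⟩

theorem treeIso_mem_uniformPoints (α : M) (g : CAut M) (c : CTreeStar M)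
    (hc : c ∈ uniformPoints α) : treeIso g c ∈ uniformPoints α := by
  refine ⟨treeIso_mem_theta1_diff g c hc.1, fun γ hγ => ?_⟩
  have h1 := apply_mem_offBranch (g.symm : CAut M) hγ
  rw [treeIso_symm_treeIso] at h1
  exact fun φ => (hc.2 h1 φ).trans (sameType_apply (g.symm : CAut M) γ φ).symm

theorem treeIso_mem_thetaI (g : CAut M) (x : CTreeStar M) (hx : x ∈ ThetaI M) :
    treeIso g x ∈ ThetaI M := by
  obtain ⟨h, α, K, J, hK, hne, hJ, hx⟩ := hx
  refine ⟨treeIso_mem_theta1_diff g x h, α, _, treeIso g '' J, isBranchOf_theta1_image g hK,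
    hne.image _, ⟨⟨hJ.1.1.image _, ?_⟩, ?_⟩, (treeIso g).isGLB_image'.2 hx⟩
  · rintro _ ⟨y, hy, rfl⟩
    exact treeIso_mem_uniformPoints α g y (hJ.1.2 hy)
  · rintro J' ⟨h1, h2⟩ hJJ'
    have h3 : (treeIso g).symm '' J' ⊆ J := by
      refine hJ.2 ⟨?_, ?_⟩ ?_
      · have := h1.image (treeIso g).symm
        rwa [OrderIso.symm_image_image] at this
      · rintro _ ⟨y, hy, rfl⟩
        exact treeIso_mem_uniformPoints α g.symm y (h2 hy)
      · exact fun y hy => ⟨treeIso g y, hJJ' ⟨y, hy, rfl⟩, by simp⟩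
    exact fun y hy => ⟨(treeIso g).symm y, h3 ⟨y, hy, rfl⟩, by simp⟩

theorem treeIso_mem_theta (g : CAut M) (x : CTreeStar M) (hx : x ∈ Theta M) :
    treeIso g x ∈ Theta M :=
  hx.imp (Or.imp (Or.imp (treeIso_mem_thetaU g x) (treeIso_mem_thetaB g x))
    (treeIso_mem_thetaS g x)) (treeIso_mem_thetaI g x)

end CTreeStar

/-! ### Cones with the same theory are isomorphic -/

section TreeEquiv

variable {P : Type u} [PartialOrder P]

theorem orderMeet_map {G G' : Type u} [PartialOrder G] [PartialOrder G'] (e : G ≃o G') (x y : G) :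
    e (orderMeet x y) = orderMeet (e x) (e y) := by
  have key : ∀ z, IsGLB {e x, e y} (e z) ↔ IsGLB {x, y} z := fun z => by
    rw [← image_pair]
    exact e.isGLB_image'
  by_cases h : ∃ z, IsGLB {x, y} z
  · have h' : ∃ z, IsGLB {e x, e y} z := h.imp' e fun z => (key z).2
    rw [orderMeet, orderMeet, dif_pos h, dif_pos h']
    exact ((key _).2 h.choose_spec).unique h'.choose_spec
  · have h' : ¬ ∃ z, IsGLB {e x, e y} z := fun ⟨z, hz⟩ =>
      h ⟨e.symm z, (key _).1 (by rwa [e.apply_symm_apply])⟩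
    rw [orderMeet, orderMeet, dif_neg h, dif_neg h']

/-- An order isomorphism is an isomorphism of trees. -/
noncomputable def treeEquiv {G G' : Set P} (e : G ≃o G') : G ≃[TreeLang] G' where
  toEquiv := e.toEquiv
  map_fun' := fun f v => by
    cases f with
    | meet => exact orderMeet_map e _ _
  map_rel' := fun r v => by
    cases r with
    | le => exact e.le_iff_le
    | isLeaf => exact e.isMax_apply
    | isNode => exact not_congr e.isMax_apply

/-- An order isomorphism compatible with the subsets `V` and `V'` is an isomorphism of expanded
trees. -/
noncomputable def treeVEquiv {G G' : Set P} (e : G ≃o G') (V : Set G) (V' : Set G')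
    (h : ∀ x, e x ∈ V' ↔ x ∈ V) :
    letI := vStructure V
    letI := vStructure V'
    G ≃[TreeVLang] G' :=
  letI := vStructure V
  letI := vStructure V'
  { toEquiv := e.toEquiv
    map_fun' := fun f v => by
      rcases f with f | f
      · exact (treeEquiv e).map_fun f v
      · exact (f : Empty).elim
    map_rel' := fun r v => by
      rcases r with r | r
      · exact (treeEquiv e).map_rel r v
      · cases r with
        | V => exact h _ }

theorem exists_orderIso_of_treeEquiv {G G' : Set P} (e : G ≃[TreeLang] G') :
    ∃ e' : G ≃o G', ∀ x, e' x = e x :=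
  ⟨{ toEquiv := e.toEquiv
     map_rel_iff' := fun {x y} => e.map_rel (TreeRel.le : TreeLang.Relations 2) ![x, y] },
    fun _ => rfl⟩

theorem exists_orderIso_of_treeVEquiv {G G' : Set P} (V : Set G) (V' : Set G')
    (e : letI := vStructure V
      letI := vStructure V'
      G ≃[TreeVLang] G') :
    ∃ e' : G ≃o G', ∀ x, e' x ∈ V' ↔ x ∈ V := by
  let := vStructure V
  let := vStructure V'
  exact ⟨{ toEquiv := e.toEquiv
           map_rel_iff' := fun {x y} =>
            e.map_rel (Sum.inl TreeRel.le : TreeVLang.Relations 2) ![x, y] },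
    fun x => e.map_rel (Sum.inr VRel.V : TreeVLang.Relations 1) ![x]⟩

/-- An order isomorphism between two subsets of an order. -/
def SetIso (S S' : Set P) (f : P → P) : Prop :=
  BijOn f S S' ∧ ∀ x ∈ S, ∀ y ∈ S, f x ≤ f y ↔ x ≤ y

theorem SetIso.lt_iff {S S' : Set P} {f : P → P} (h : SetIso S S' f) {x y : P} (hx : x ∈ S)
    (hy : y ∈ S) : f x < f y ↔ x < y := by
  rw [lt_iff_le_not_ge, lt_iff_le_not_ge, h.2 x hx y hy, h.2 y hy x hx]

-- Maps defined on all of `P` can be glued without transport between subtypes; the values off `S`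
-- play no role.
open Classical in
theorem exists_setIso_of_orderIso {S S' : Set P} (e : S ≃o S') :
    ∃ f, SetIso S S' f ∧ ∀ x : S, f x = e x := by
  have key : ∀ x : S, (if h : (x : P) ∈ S then (e ⟨x, h⟩ : P) else x) = e x :=
    fun x => dif_pos x.2
  refine ⟨fun x => if h : x ∈ S then e ⟨x, h⟩ else x, ⟨⟨fun x hx => ?_, ?_, ?_⟩, ?_⟩, key⟩
  · have h1 : (if h : x ∈ S then (e ⟨x, h⟩ : P) else x) ∈ S' := by
      rw [key ⟨x, hx⟩]
      exact (e ⟨x, hx⟩).2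
    exact h1
  · intro x hx y hy hxy
    have h1 : (e ⟨x, hx⟩ : P) = e ⟨y, hy⟩ := (key ⟨x, hx⟩).symm.trans (hxy.trans (key ⟨y, hy⟩))
    exact congrArg Subtype.val (e.injective (Subtype.ext h1))
  · intro y hy
    exact ⟨e.symm ⟨y, hy⟩, (e.symm ⟨y, hy⟩).2, (key _).trans (by simp)⟩
  · intro x hx y hy
    have h1 := key ⟨x, hx⟩
    have h2 := key ⟨y, hy⟩
    change (if h : x ∈ S then (e ⟨x, h⟩ : P) else x) ≤
      (if h : y ∈ S then (e ⟨y, h⟩ : P) else y) ↔ x ≤ y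
    rw [h1, h2, Subtype.coe_le_coe, e.le_iff_le, Subtype.mk_le_mk]

/-- The restriction of an order isomorphism. -/
noncomputable def restrictOrderIso (θ : P ≃o P) {S S' : Set P} (h : ∀ x, θ x ∈ S' ↔ x ∈ S) :
    S ≃o S' where
  toEquiv := θ.toEquiv.subtypeEquiv fun x => (h x).symm
  map_rel_iff' := θ.le_iff_le

theorem mem_treeCone_map (θ : P ≃o P) (a y t : P) :
    θ t ∈ treeCone (θ a) (θ y) ↔ t ∈ treeCone a y := by
  constructor
  · rintro ⟨z, h1, h2, h3⟩
    exact ⟨θ.symm z, by simpa [θ.lt_symm_apply], by simpa [θ.symm_apply_le],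
      by simpa [θ.symm_apply_le]⟩
  · rintro ⟨z, h1, h2, h3⟩
    exact ⟨θ z, θ.lt_iff_lt.2 h1, θ.le_iff_le.2 h2, θ.le_iff_le.2 h3⟩

theorem treeCone_map (θ : P ≃o P) (a y : P) : treeCone (θ a) (θ y) = θ '' treeCone a y := by
  ext t
  obtain ⟨t, rfl⟩ := θ.surjective t
  rw [mem_treeCone_map, θ.injective.mem_set_image]

theorem mem_prunedCone_map (θ : P ≃o P) (b a t : P) :
    θ t ∈ prunedCone (θ b) (θ a) ↔ t ∈ prunedCone b a := by
  simp only [prunedCone, mem_sdiff, mem_treeCone_map, mem_ofPred_eq, θ.le_iff_le]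

theorem completeTheory_image (θ : P ≃o P) (G : Set P) :
    TreeLang.completeTheory (θ '' G) = TreeLang.completeTheory G :=
  (StrongHomClass.elementarilyEquivalent
    (treeEquiv (restrictOrderIso θ (S := G) (S' := θ '' G)
      fun _ => θ.injective.mem_set_image))).symm

theorem prunedTheory_map (θ : P ≃o P) (b a : P) :
    prunedTheory (θ b) (θ a) = prunedTheory b a := by
  let := vStructure {x : prunedCone b a | (x : P) < a}
  let := vStructure {x : prunedCone (θ b) (θ a) | (x : P) < θ a}
  exact (StrongHomClass.elementarilyEquivalent
    (treeVEquiv (restrictOrderIso θ (mem_prunedCone_map θ b a))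
      {x : prunedCone b a | (x : P) < a} {x : prunedCone (θ b) (θ a) | (x : P) < θ a}
      fun _ => θ.lt_iff_lt)).symm

end TreeEquiv

namespace CTreeStar

variable {M : Type u} [CSet M]

theorem finite_range_of_factors {α β γ : Type*} {f : α → β} {g : α → γ} (hf : (range f).Finite)
    (h : ∀ x y, f x = f y → g x = g y) : (range g).Finite := by
  rcases isEmpty_or_nonempty α with hα | hα
  · exact finite_range g
  refine (hf.image fun v => g (Function.invFun f v)).subset ?_
  rintro _ ⟨x, rfl⟩
  exact ⟨f x, ⟨x, rfl⟩, h _ _ (Function.invFun_eq ⟨x, rfl⟩)⟩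

theorem treeIso_of_isBot (g : CAut M) {x : CTreeStar M} (hx : IsBot x) : treeIso g x = x := by
  refine le_antisymm ?_ (hx _)
  rw [← OrderIso.le_symm_apply]
  exact hx _

/-- A node is coded by two leaves, or is the bottom. Tuples whose codes, together with those of `a`
and `b`, have the same type in `M` are conjugate under an automorphism fixing `a` and `b`, which
acts on `G`. -/
theorem hasFinitelyManyTypes_of_fixing [Countable M] [Nonempty M]
    (hM : HasFinitelyManyTypes CLang M) {L : Language} (G : Set (CTreeStar M)) [L.Structure G]
    (a b : CTreeStar M)
    (h : ∀ g : CAut M, treeIso g a = a → treeIso g b = b →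
      ∃ e : G ≃[L] G, ∀ x : G, (e x : CTreeStar M) = treeIso g x) :
    HasFinitelyManyTypes L G := by
  have hrep : ∀ x : CTreeStar M, ∃ p : Bool → M, IsBot x ∨ x = leaf (p true) ⊓ leaf (p false) := by
    intro x
    rcases isBot_or_eq_inf x with hx | ⟨α, β, hx⟩
    · exact ⟨fun _ => Classical.arbitrary M, Or.inl hx⟩
    · exact ⟨fun i => if i then α else β, Or.inr hx⟩
  choose p hp using hrep
  have hfix : ∀ (g : CAut M) (x y : CTreeStar M), (∀ i, g (p x i) = p y i) → (IsBot x ↔ IsBot y) →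
      treeIso g x = y := by
    intro g x y hg hbot
    by_cases hx : IsBot x
    · rw [treeIso_of_isBot g hx]
      exact le_antisymm (hx _) (hbot.1 hx _)
    · have h1 := (hp x).resolve_left hx
      have h2 := (hp y).resolve_left (mt hbot.2 hx)
      conv_lhs => rw [h1]
      rw [OrderIso.map_inf, treeIso_leaf, treeIso_leaf, hg, hg, ← h2]
  intro n
  let c : (Fin n → G) → ((Fin n × Bool) ⊕ (Bool × Bool)) → M := fun t =>
    Sum.elim (fun i => p (t i.1) i.2) fun i => p (if i.1 then a else b) i.2
  -- The code of the bottom may be arbitrary, so the positions where it occurs are recorded as well.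
  refine finite_range_of_factors
    (f := fun t : Fin n → G => (tupleType CLang (c t), {i | IsBot (t i : CTreeStar M)})) ?_ ?_
  · refine ((((hM.of_finite ((Fin n × Bool) ⊕ (Bool × Bool)))).prod
      (toFinite (univ : Set (Set (Fin n)))))).subset ?_
    rintro _ ⟨t, rfl⟩
    exact ⟨⟨_, rfl⟩, mem_univ _⟩
  · intro t t' htt'
    obtain ⟨h1, h2⟩ := Prod.mk.inj htt'
    obtain ⟨g, hg⟩ := exists_automorphism_of_tupleType_eq hM h1
    obtain ⟨e, he⟩ := h g (hfix g a a (fun i => hg (.inr (true, i))) Iff.rfl)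
      (hfix g b b (fun i => hg (.inr (false, i))) Iff.rfl)
    rw [← tupleType_equiv e t]
    congr 1
    funext i
    exact Subtype.ext ((he _).trans
      (hfix g _ _ (fun j => hg (.inl (i, j))) (Set.ext_iff.1 h2 i)))

theorem exists_setIso_of_completeTheory_eq [Countable M] [Nonempty M]
    (hM : HasFinitelyManyTypes CLang M) {a y a' y' : CTreeStar M}
    (h : TreeLang.completeTheory (treeCone a y) = TreeLang.completeTheory (treeCone a' y')) :
    ∃ f, SetIso (treeCone a y) (treeCone a' y') f := by
  have key : ∀ a y : CTreeStar M, HasFinitelyManyTypes TreeLang (treeCone a y) := fun a y =>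
    hasFinitelyManyTypes_of_fixing hM _ a y fun g ha hy =>
      ⟨treeEquiv (restrictOrderIso (treeIso g) fun x => by
        conv_lhs => rw [← ha, ← hy, mem_treeCone_map]), fun x => rfl⟩
  obtain ⟨e⟩ := nonempty_equiv_of_completeTheory_eq (key a y) (key a' y') h
  obtain ⟨e', -⟩ := exists_orderIso_of_treeEquiv e
  obtain ⟨f, hf, -⟩ := exists_setIso_of_orderIso e'
  exact ⟨f, hf⟩

theorem exists_setIso_of_prunedTheory_eq [Countable M] [Nonempty M]
    (hM : HasFinitelyManyTypes CLang M) {b a b' a' : CTreeStar M}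
    (h : prunedTheory b a = prunedTheory b' a') :
    ∃ f, SetIso (prunedCone b a) (prunedCone b' a') f ∧
      ∀ x ∈ prunedCone b a, f x < a' ↔ x < a := by
  have key : ∀ b a : CTreeStar M, letI := vStructure {x : prunedCone b a | (x : CTreeStar M) < a}
      HasFinitelyManyTypes TreeVLang (prunedCone b a) := fun b a =>
    letI := vStructure {x : prunedCone b a | (x : CTreeStar M) < a}
    hasFinitelyManyTypes_of_fixing hM _ b a fun g hb ha =>
      ⟨treeVEquiv (restrictOrderIso (treeIso g) fun x => by
        conv_lhs => rw [← hb, ← ha, mem_prunedCone_map]) _ _ fun x => by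
          have := (treeIso g).lt_iff_lt (x := x) (y := a)
          rwa [ha] at this, fun x => rfl⟩
  let := vStructure {x : prunedCone b a | (x : CTreeStar M) < a}
  let := vStructure {x : prunedCone b' a' | (x : CTreeStar M) < a'}
  obtain ⟨e⟩ := nonempty_equiv_of_completeTheory_eq (key b a) (key b' a') h
  obtain ⟨e', he'⟩ := exists_orderIso_of_treeVEquiv _ _ e
  obtain ⟨f, hf, hfe⟩ := exists_setIso_of_orderIso e'
  exact ⟨f, hf, fun x hx => by rw [hfe ⟨x, hx⟩]; exact he' ⟨x, hx⟩⟩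

end CTreeStar

/-! ### Gluing isomorphisms of cones -/

section Glue

variable {P : Type u} [PartialOrder P]

theorem SetIso.apply_eq_of_Ici {a a' : P} {f : P → P} (h : SetIso (Ici a) (Ici a') f) :
    f a = a' := by
  obtain ⟨x, hx, hxa⟩ := h.1.surjOn (self_mem_Ici (a := a'))
  refine le_antisymm ?_ (h.1.mapsTo self_mem_Ici)
  rw [← hxa]
  exact (h.2 a self_mem_Ici x hx).2 hx

open Classical in
theorem exists_setIso_Ici_of_cones {a a' : P} {ι ι' : Type*} (G : ι → Set P) (G' : ι' → Set P)
    (hcov : ∀ x, a < x ↔ ∃ i, x ∈ G i) (hcov' : ∀ x, a' < x ↔ ∃ i, x ∈ G' i)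
    (hinc : ∀ i j, ∀ x ∈ G i, ∀ y ∈ G j, x ≤ y → i = j)
    (hinc' : ∀ i j, ∀ x ∈ G' i, ∀ y ∈ G' j, x ≤ y → i = j)
    (e : ι ≃ ι') (h : ∀ i, ∃ f, SetIso (G i) (G' (e i)) f) :
    ∃ f, SetIso (Ici a) (Ici a') f := by
  choose f hf using h
  -- The default value `a'` serves for `a`, the only point of the thick cone outside the cones.
  let F : P → P := fun x => if h : ∃ i, x ∈ G i then f h.choose x else a'
  have hF : ∀ i, ∀ x ∈ G i, F x = f i x := by
    intro i x hx
    have hex : ∃ i, x ∈ G i := ⟨i, hx⟩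
    have : hex.choose = i := hinc _ _ x hex.choose_spec x hx le_rfl
    simp only [F, dif_pos hex, this]
  have hFa : F a = a' := dif_neg fun h => lt_irrefl a ((hcov a).2 h)
  have hmem : ∀ i, ∀ x ∈ G i, F x ∈ G' (e i) := fun i x hx => by
    rw [hF i x hx]
    exact (hf i).1.mapsTo hx
  have hsplit : ∀ x ∈ Ici a, x = a ∨ ∃ i, x ∈ G i := fun x hx => by
    rcases eq_or_lt_of_le (mem_Ici.1 hx) with h | h
    · exact Or.inl h.symm
    · exact Or.inr ((hcov x).1 h)
  have hle : ∀ x ∈ Ici a, ∀ y ∈ Ici a, F x ≤ F y ↔ x ≤ y := by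
    intro x hx y hy
    rcases hsplit x hx with rfl | ⟨i, hi⟩
    · rw [hFa]
      refine ⟨fun _ => hy, fun _ => ?_⟩
      rcases hsplit y hy with rfl | ⟨j, hj⟩
      · exact hFa.ge
      · exact ((hcov' _).2 ⟨_, hmem j y hj⟩).le
    · rcases hsplit y hy with rfl | ⟨j, hj⟩
      · rw [hFa]
        exact ⟨fun h => absurd h ((hcov' _).2 ⟨_, hmem i x hi⟩).not_ge,
          fun h => absurd h ((hcov _).2 ⟨_, hi⟩).not_ge⟩
      · by_cases hij : i = j
        · subst hij
          rw [hF i x hi, hF i y hj, (hf i).2 x hi y hj]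
        · exact ⟨fun h => absurd (e.injective (hinc' _ _ _ (hmem i x hi) _ (hmem j y hj) h)) hij,
            fun h => absurd (hinc _ _ _ hi _ hj h) hij⟩
  refine ⟨F, ⟨fun x hx => ?_, fun x hx y hy hxy => ?_, fun y hy => ?_⟩, hle⟩
  · rcases hsplit x hx with rfl | ⟨i, hi⟩
    · exact hFa.ge
    · exact ((hcov' _).2 ⟨_, hmem i x hi⟩).le
  · exact le_antisymm ((hle x hx y hy).1 hxy.le) ((hle y hy x hx).1 hxy.ge)
  · rcases eq_or_lt_of_le (mem_Ici.1 hy) with rfl | h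
    · exact ⟨a, self_mem_Ici, hFa⟩
    · obtain ⟨j, hj⟩ := (hcov' y).1 h
      obtain ⟨i, rfl⟩ := e.surjective j
      obtain ⟨x, hx, rfl⟩ := (hf i).1.surjOn hj
      exact ⟨x, ((hcov x).2 ⟨i, hx⟩).le, hF i x hx⟩

/-- Countability makes any two infinite fibers equinumerous, so counts in `ℕ ∪ {∞}` are enough. -/
theorem exists_equiv_of_card_fiber_eq {α β γ : Type*} [Countable α] [Countable β] (f : α → γ)
    (g : β → γ) (h : ∀ c, ENat.card {a // f a = c} = ENat.card {b // g b = c}) :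
    ∃ e : α ≃ β, ∀ a, g (e a) = f a := by
  have key : ∀ c, Nonempty ({a // f a = c} ≃ {b // g b = c}) := by
    intro c
    rcases finite_or_infinite {a // f a = c} with hfin | hinf
    · have hfin' : Finite {b // g b = c} := by
        rw [← ENat.card_lt_top, ← h c, ENat.card_lt_top]
        exact hfin
      refine Finite.card_eq.1 ?_
      have := h c
      rw [ENat.card_eq_coe_natCard, ENat.card_eq_coe_natCard] at this
      exact_mod_cast this
    · have hinf' : Infinite {b // g b = c} := by
        rw [← ENat.card_eq_top, ← h c, ENat.card_eq_top]
        exact hinf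
      exact nonempty_equiv_of_countable
  exact ⟨Equiv.ofFiberEquiv fun c => (key c).some, Equiv.ofFiberEquiv_map _⟩

end Glue

namespace CTreeStar

variable {M : Type u} [CSet M]

theorem mem_prunedCone {b a t : CTreeStar M} : t ∈ prunedCone b a ↔ b < t ⊓ a ∧ ¬ a ≤ t := by
  rw [prunedCone, mem_sdiff, mem_treeCone, mem_ofPred_eq]

/-- The only order relation between the pruned cone and the thick cone at `a` is given by the
predicate `V`. This is why isomorphisms preserving `V` can be glued. -/
theorem le_iff_lt_of_mem_prunedCone {b a x y : CTreeStar M} (hx : x ∈ prunedCone b a)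
    (hy : a ≤ y) : x ≤ y ↔ x < a := by
  have hx' := (mem_prunedCone.1 hx).2
  exact ⟨fun h => ((le_total_of_le h hy).resolve_right hx').lt_of_not_ge hx',
    fun h => h.le.trans hy⟩

open Classical in
theorem exists_setIso_treeCone {b a b' a' : CTreeStar M} (hba : b < a) (hba' : b' < a')
    {f g : CTreeStar M → CTreeStar M} (hf : SetIso (prunedCone b a) (prunedCone b' a') f)
    (hfV : ∀ x ∈ prunedCone b a, f x < a' ↔ x < a) (hg : SetIso (Ici a) (Ici a') g) :
    ∃ F, SetIso (treeCone b a) (treeCone b' a') F ∧ F a = a' := by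
  have hIci : ∀ {b a x : CTreeStar M}, b < a → a ≤ x → x ∈ treeCone b a := fun h hx =>
    mem_treeCone.2 (by rwa [inf_eq_right.2 hx])
  have hsplit : ∀ {b a x : CTreeStar M}, x ∈ treeCone b a → x ∈ prunedCone b a ∨ a ≤ x :=
    fun {b a x} hx => or_iff_not_imp_right.2 fun h => ⟨hx, h⟩
  let F : CTreeStar M → CTreeStar M := fun x => if a ≤ x then g x else f x
  have hF₁ : ∀ x, a ≤ x → F x = g x := fun x hx => if_pos hx
  have hF₂ : ∀ x ∈ prunedCone b a, F x = f x := fun x hx => if_neg hx.2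
  have hle : ∀ x ∈ treeCone b a, ∀ y ∈ treeCone b a, F x ≤ F y ↔ x ≤ y := by
    intro x hx y hy
    rcases hsplit hx with hx | hx <;> rcases hsplit hy with hy | hy
    · rw [hF₂ x hx, hF₂ y hy, hf.2 x hx y hy]
    · rw [hF₂ x hx, hF₁ y hy, le_iff_lt_of_mem_prunedCone hx hy,
        le_iff_lt_of_mem_prunedCone (hf.1.mapsTo hx) (hg.1.mapsTo hy), hfV x hx]
    · rw [hF₁ x hx, hF₂ y hy]
      exact ⟨fun h => absurd ((mem_Ici.1 (hg.1.mapsTo hx)).trans h) (hf.1.mapsTo hy).2,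
        fun h => absurd (hx.trans h) hy.2⟩
    · rw [hF₁ x hx, hF₁ y hy, hg.2 x hx y hy]
  refine ⟨F, ⟨⟨fun x hx => ?_, fun x hx y hy hxy => ?_, fun y hy => ?_⟩, hle⟩, ?_⟩
  · rcases hsplit hx with hx | hx
    · rw [hF₂ x hx]
      exact (hf.1.mapsTo hx).1
    · rw [hF₁ x hx]
      exact hIci hba' (hg.1.mapsTo hx)
  · exact le_antisymm ((hle x hx y hy).1 hxy.le) ((hle y hy x hx).1 hxy.ge)
  · rcases hsplit hy with hy | hy
    · obtain ⟨x, hx, rfl⟩ := hf.1.surjOn hy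
      exact ⟨x, hx.1, hF₂ x hx⟩
    · obtain ⟨x, hx, rfl⟩ := hg.1.surjOn hy
      exact ⟨x, hIci hba hx, hF₁ x hx⟩
  · rw [hF₁ a le_rfl, hg.apply_eq_of_Ici]

theorem treeCone_upper {b a x y : CTreeStar M} (hx : x ∈ treeCone b a) (h : x ≤ y) :
    y ∈ treeCone b a := by
  rw [mem_treeCone] at hx ⊢
  exact hx.trans_le (inf_le_inf_right _ h)

/-- Going down out of a cone at `b` leads to `b` or below, so a map that only permutes whole cones
at `b` is monotone. -/
theorem le_of_notMem_treeCone {b a x y : CTreeStar M} (hy : y ∈ treeCone b a) (h : x ≤ y)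
    (hx : x ∉ treeCone b a) : x ≤ b := by
  rw [mem_treeCone] at hy hx
  refine (le_total_of_le h (hy.le.trans inf_le_left)).elim id fun hbx => ?_
  by_contra hxb
  refine hx (lt_inf_trans (y := y) ?_ hy)
  rw [inf_eq_left.2 h]
  exact hbx.lt_of_not_ge hxb

theorem SetIso.exists_inverse {P : Type*} [PartialOrder P] [Nonempty P] {S S' : Set P} {f : P → P}
    (h : SetIso S S' f) : ∃ g, SetIso S' S g ∧ (∀ x ∈ S, g (f x) = x) ∧ ∀ y ∈ S', f (g y) = y := by
  have hinv := h.1.invOn_invFunOn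
  have hmaps := h.1.surjOn.mapsTo_invFunOn
  refine ⟨_, ⟨(bijOn_comm hinv.symm).1 h.1, fun x hx y hy => ?_⟩, hinv.1, hinv.2⟩
  rw [← h.2 _ (hmaps hx) _ (hmaps hy), hinv.2 hx, hinv.2 hy]

open Classical in
/-- Two disjoint isomorphic cones at a same point can be swapped. -/
theorem exists_orderIso_swap {b c c' : CTreeStar M} (hbc : b < c)
    (hdisj : Disjoint (treeCone b c) (treeCone b c')) {f : CTreeStar M → CTreeStar M}
    (hf : SetIso (treeCone b c) (treeCone b c') f) :
    ∃ θ : CTreeStar M ≃o CTreeStar M, θ c = f c := by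
  have : Nonempty (CTreeStar M) := ⟨b⟩
  obtain ⟨g, hg, hgf, hfg⟩ := SetIso.exists_inverse hf
  have hlt : ∀ {a x}, x ∈ treeCone b a → b < x := fun hx => (mem_treeCone.1 hx).trans_le inf_le_left
  have hdis : ∀ x ∈ treeCone b c', x ∉ treeCone b c := fun x hx hx' =>
    disjoint_left.1 hdisj hx' hx
  let F : CTreeStar M → CTreeStar M := fun x =>
    if x ∈ treeCone b c then f x else if x ∈ treeCone b c' then g x else x
  have hF₁ : ∀ x ∈ treeCone b c, F x = f x := fun x hx => if_pos hx
  have hF₂ : ∀ x ∈ treeCone b c', F x = g x := fun x hx => by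
    simp only [F, if_neg (hdis x hx), if_pos hx]
  have hF₃ : ∀ x, x ∉ treeCone b c → x ∉ treeCone b c' → F x = x := fun x h1 h2 => by
    simp only [F, if_neg h1, if_neg h2]
  have hmono : Monotone F := by
    intro x y hxy
    by_cases hx : x ∈ treeCone b c
    · have hy := treeCone_upper hx hxy
      rw [hF₁ x hx, hF₁ y hy]
      exact (hf.2 x hx y hy).2 hxy
    by_cases hx' : x ∈ treeCone b c'
    · have hy := treeCone_upper hx' hxy
      rw [hF₂ x hx', hF₂ y hy]
      exact (hg.2 x hx' y hy).2 hxy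
    rw [hF₃ x hx hx']
    by_cases hy : y ∈ treeCone b c
    · rw [hF₁ y hy]
      exact (le_of_notMem_treeCone hy hxy hx).trans (hlt (hf.1.mapsTo hy)).le
    by_cases hy' : y ∈ treeCone b c'
    · rw [hF₂ y hy']
      exact (le_of_notMem_treeCone hy' hxy hx').trans (hlt (hg.1.mapsTo hy')).le
    rwa [hF₃ y hy hy']
  have hinv : Function.Involutive F := by
    intro x
    by_cases hx : x ∈ treeCone b c
    · rw [hF₁ x hx, hF₂ _ (hf.1.mapsTo hx), hgf x hx]
    by_cases hx' : x ∈ treeCone b c'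
    · rw [hF₂ x hx', hF₁ _ (hg.1.mapsTo hx'), hfg x hx']
    rw [hF₃ x hx hx', hF₃ x hx hx']
  exact ⟨Equiv.toOrderIso hinv.toPerm hmono hmono,
    hF₁ c (mem_treeCone.2 (by rwa [inf_idem]))⟩

end CTreeStar

/-! ### Orbits and labels -/

namespace CTreeStar

variable {M : Type u} [CSet M]

theorem nonempty_of_mem_theta {x : CTreeStar M} (hx : x ∈ Theta M) : Nonempty M := by
  have key : ∀ y ∈ Theta1 M, Nonempty M := fun y ⟨α, _⟩ => ⟨α⟩
  rw [Theta, union_assoc, union_assoc, ← union_assoc (ThetaB M)] at hx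
  rcases hx with ⟨K, ⟨k, hk⟩, hK, -⟩ | hx
  · exact key k (hK.1.1 hk)
  · exact key x (theta_subset hx)

section Orbits

variable {A B C : ThetaBar M} {a b c : CTreeStar M}

theorem mem_theta_of_mem (ha : a ∈ A.1) : a ∈ Theta M := by
  obtain ⟨x, hx, h⟩ := A.2
  rw [h] at ha
  obtain ⟨g, rfl⟩ := ha
  exact treeIso_mem_theta g x hx

theorem exists_mem (A : ThetaBar M) : ∃ a, a ∈ A.1 := by
  obtain ⟨x, hx, h⟩ := A.2
  exact ⟨treeIso (Language.Equiv.refl CLang M) x, by rw [h]; exact ⟨_, rfl⟩⟩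

theorem nonempty_of_thetaBar (A : ThetaBar M) : Nonempty M :=
  let ⟨_, ha⟩ := exists_mem A
  nonempty_of_mem_theta (mem_theta_of_mem ha)

theorem exists_treeIso_of_mem (ha : a ∈ A.1) (hb : b ∈ A.1) : ∃ g : CAut M, treeIso g a = b := by
  have := nonempty_of_thetaBar A
  obtain ⟨x, hx, h⟩ := A.2
  rw [h] at ha hb
  obtain ⟨g₁, h₁⟩ := ha
  obtain ⟨g₂, h₂⟩ := hb
  obtain ⟨g, hg⟩ := exists_treeIso_eq ((treeIso g₁).symm.trans (treeIso g₂))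
  refine ⟨g, ?_⟩
  rw [hg, ← h₁, ← h₂]
  exact congrArg (treeIso g₂) ((treeIso g₁).symm_apply_apply x)

theorem treeIso_mem (ha : a ∈ A.1) (g : CAut M) : treeIso g a ∈ A.1 := by
  have := nonempty_of_thetaBar A
  obtain ⟨x, hx, h⟩ := A.2
  rw [h] at ha ⊢
  obtain ⟨g₁, rfl⟩ := ha
  obtain ⟨k, hk⟩ := exists_treeIso_eq ((treeIso g₁).trans (treeIso g))
  exact ⟨k, congrArg (fun e => e x) hk⟩

theorem eq_of_mem (ha : a ∈ A.1) (hb : a ∈ B.1) : A = B := by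
  refine Subtype.ext (Set.ext fun x => ⟨fun hx => ?_, fun hx => ?_⟩)
  · obtain ⟨g, rfl⟩ := exists_treeIso_of_mem ha hx
    exact treeIso_mem hb g
  · obtain ⟨g, rfl⟩ := exists_treeIso_of_mem hb hx
    exact treeIso_mem ha g

theorem exists_mem_thetaBar (ha : a ∈ Theta M) : ∃ A : ThetaBar M, a ∈ A.1 := by
  have := nonempty_of_mem_theta ha
  obtain ⟨g, hg⟩ := exists_treeIso_eq (OrderIso.refl (CTreeStar M))
  exact ⟨⟨_, a, ha, rfl⟩, g, congrArg (fun e => e a) hg⟩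

theorem antichainLT_of_lt (ha : a ∈ A.1) (hb : b ∈ B.1) (h : a < b) : AntichainLT A.1 B.1 := by
  constructor
  · intro x hx
    obtain ⟨g, rfl⟩ := exists_treeIso_of_mem ha hx
    exact ⟨_, treeIso_mem hb g, (treeIso g).lt_iff_lt.2 h⟩
  · intro x hx
    obtain ⟨g, rfl⟩ := exists_treeIso_of_mem hb hx
    exact ⟨_, treeIso_mem ha g, (treeIso g).lt_iff_lt.2 h⟩

/-- Orbits are antichains: if `g` moved `a` strictly up, the finite sets of elements of `Θ` below
`a` and below its image would have the same size, yet the second contains the first and `a` too. -/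
theorem eq_of_le (hfin : (Theta M).Finite) (ha : a ∈ A.1) (hb : b ∈ A.1) (h : a ≤ b) : a = b := by
  by_contra hne
  obtain ⟨g, rfl⟩ := exists_treeIso_of_mem ha hb
  have hlt : a < treeIso g a := lt_of_le_of_ne h hne
  have hsub : {x | x ∈ Theta M ∧ x < a} ⊂ {x | x ∈ Theta M ∧ x < treeIso g a} :=
    ⟨fun x hx => ⟨hx.1, hx.2.trans hlt⟩,
      fun h => lt_irrefl a (h ⟨mem_theta_of_mem ha, hlt⟩).2⟩
  have heq : {x | x ∈ Theta M ∧ x < treeIso g a} = treeIso g '' {x | x ∈ Theta M ∧ x < a} := by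
    ext x
    obtain ⟨x, rfl⟩ := (treeIso g).surjective x
    rw [(treeIso g).injective.mem_set_image]
    simp only [mem_ofPred_eq, OrderIso.lt_iff_lt, treeIso_mem_iff treeIso_mem_theta]
  have := ncard_lt_ncard hsub (hfin.subset fun x hx => hx.1)
  rw [heq, ncard_image_of_injective _ (treeIso g).injective] at this
  exact lt_irrefl _ this

theorem eq_of_le_of_le (hfin : (Theta M).Finite) (ha : a ∈ A.1) (hb : b ∈ A.1) (hac : a ≤ c)
    (hbc : b ≤ c) : a = b :=
  (le_total_of_le hac hbc).elim (eq_of_le hfin ha hb) fun h => (eq_of_le hfin hb ha h).symm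

/-- `c` is a successor of `a` in `Θ`. -/
def IsSuccOf (a c : CTreeStar M) : Prop :=
  c ∈ Theta M ∧ a < c ∧ ∀ x ∈ Theta M, a < x → ¬ x < c

/-- Since each orbit is an antichain, a point has at most one element of it below; so an orbit lying
between `A` and `C` passes between `a` and `c` themselves. -/
theorem isPredOf_iff (hfin : (Theta M).Finite) (ha : a ∈ A.1) (hc : c ∈ C.1) (hac : a < c) :
    IsPredOf A C ↔ IsSuccOf a c := by
  constructor
  · rintro ⟨-, h⟩
    refine ⟨mem_theta_of_mem hc, hac, fun x hx hax hxc => h ?_⟩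
    obtain ⟨D, hD⟩ := exists_mem_thetaBar hx
    exact ⟨D, antichainLT_of_lt ha hD hax, antichainLT_of_lt hD hc hxc⟩
  · rintro ⟨-, -, h⟩
    refine ⟨antichainLT_of_lt ha hc hac, ?_⟩
    rintro ⟨D, hAD, hDC⟩
    obtain ⟨d, hd, hdc⟩ := hDC.2 c hc
    obtain ⟨a', ha', had⟩ := hAD.2 d hd
    obtain rfl := eq_of_le_of_le hfin ha ha' hac.le (had.trans hdc).le
    exact h d (mem_theta_of_mem hd) had hdc

theorem exists_treeIso_pair (hfin : (Theta M).Finite) {b d a c : CTreeStar M} (hb : b ∈ A.1)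
    (hd : d ∈ C.1) (hbd : b < d) (ha : a ∈ A.1) (hc : c ∈ C.1) (hac : a < c) :
    ∃ g : CAut M, treeIso g b = a ∧ treeIso g d = c := by
  obtain ⟨g, rfl⟩ := exists_treeIso_of_mem hd hc
  exact ⟨g, eq_of_le_of_le hfin (treeIso_mem hb g) ha ((treeIso g).lt_iff_lt.2 hbd).le hac.le, rfl⟩

theorem prunedCone_nonempty_map (g : CAut M) {b d : CTreeStar M} (h : (prunedCone b d).Nonempty) :
    (prunedCone (treeIso g b) (treeIso g d)).Nonempty :=
  let ⟨x, hx⟩ := h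
  ⟨treeIso g x, (mem_prunedCone_map _ _ _ _).2 hx⟩

theorem coneCount_le_map (g : CAut M) (a : CTreeStar M) (τ : TreeLang.Theory) :
    coneCount a τ ≤ coneCount (treeIso g a) τ := by
  have hinj : Function.Injective fun G : Set (CTreeStar M) => treeIso g '' G :=
    (treeIso g).injective.image_injective
  rw [coneCount, ← hinj.encard_image]
  refine encard_le_encard ?_
  rintro _ ⟨G, ⟨⟨y, hay, rfl⟩, hdisj, hτ⟩, rfl⟩
  refine ⟨⟨treeIso g y, (treeIso g).lt_iff_lt.2 hay, (treeCone_map _ _ _).symm⟩, ?_, ?_⟩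
  · have := (disjoint_image_iff (treeIso g).injective).2 hdisj
    rwa [treeIso_image_eq treeIso_mem_theta] at this
  · exact (completeTheory_image _ _).trans hτ

theorem coneCount_eq_of_mem (ha : a ∈ A.1) (hb : b ∈ A.1) (τ : TreeLang.Theory) :
    coneCount a τ = coneCount b τ := by
  obtain ⟨g, rfl⟩ := exists_treeIso_of_mem ha hb
  refine le_antisymm (coneCount_le_map g a τ) ?_
  have := coneCount_le_map (g.symm : CAut M) (treeIso g a) τ
  rwa [treeIso_symm_treeIso] at this

/-- Only nonzero counts are recorded in `labelK`, so theories missing from it have count zero on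
both sides. -/
theorem coneCount_eq_of_labelK_eq (h : labelK A = labelK B) (ha : a ∈ A.1) (hb : b ∈ B.1)
    (τ : TreeLang.Theory) : coneCount a τ = coneCount b τ := by
  have key : ∀ {A B : ThetaBar M} {a b : CTreeStar M}, labelK A = labelK B → a ∈ A.1 → b ∈ B.1 →
      coneCount a τ ≠ 0 → coneCount a τ = coneCount b τ := by
    intro A B a b h ha hb hne
    have hmem : (τ, coneCount a τ) ∈ labelK A := ⟨hne, a, ha, rfl⟩
    rw [h] at hmem
    obtain ⟨-, b', hb', hbτ⟩ := hmem
    exact hbτ.symm.trans (coneCount_eq_of_mem hb' hb τ)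
  by_cases h1 : coneCount a τ = 0
  · by_cases h2 : coneCount b τ = 0
    · rw [h1, h2]
    · exact (key h.symm hb ha h2).symm
  · exact key h ha hb h1

/-- The number of elements of `C` above an element of `A` is `n_C / n_A`. -/
theorem labelN_eq_mul (hfin : (Theta M).Finite) (hAC : IsPredOf A C) (ha : a ∈ A.1) :
    labelN C = labelN A * {c | c ∈ C.1 ∧ a < c}.ncard := by
  classical
  have hfinA : A.1.Finite := hfin.subset fun x hx => mem_theta_of_mem hx
  have hfinC : C.1.Finite := hfin.subset fun x hx => mem_theta_of_mem hx
  -- Each element of `C` is above exactly one element of `A`, and the fibers of `p` are conjugate,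
  -- hence of equal size.
  choose! p hpA hp using hAC.1.2
  have hfib : ∀ x ∈ A.1, {c | c ∈ C.1 ∧ p c = x} = {c | c ∈ C.1 ∧ x < c} := by
    intro x hx
    ext c
    refine ⟨fun h => ⟨h.1, h.2 ▸ hp c h.1⟩, fun h => ⟨h.1, ?_⟩⟩
    exact eq_of_le_of_le hfin (hpA c h.1) hx (hp c h.1).le h.2.le
  have hcard : ∀ x ∈ A.1, {c | c ∈ C.1 ∧ p c = x}.ncard = {c | c ∈ C.1 ∧ a < c}.ncard := by
    intro x hx
    rw [hfib x hx]
    obtain ⟨g, rfl⟩ := exists_treeIso_of_mem ha hx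
    rw [← ncard_image_of_injective {c | c ∈ C.1 ∧ a < c} (treeIso g).injective]
    congr 1
    ext c
    obtain ⟨c, rfl⟩ := (treeIso g).surjective c
    rw [(treeIso g).injective.mem_set_image]
    simp only [mem_ofPred_eq, OrderIso.lt_iff_lt]
    refine and_congr_left fun _ => ⟨fun h => ?_, fun h => treeIso_mem h g⟩
    have := treeIso_mem h (g.symm : CAut M)
    rwa [treeIso_symm_treeIso] at this
  have h1 := Finset.card_eq_sum_card_fiberwise (f := p) (s := hfinC.toFinset)
    (t := hfinA.toFinset) fun c hc => by
      simpa using hpA c (by simpa using hc)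
  rw [labelN, labelN, ncard_eq_toFinset_card _ hfinC, ncard_eq_toFinset_card _ hfinA, h1,
    ← smul_eq_mul, ← Finset.sum_const]
  refine Finset.sum_congr rfl fun x hx => ?_
  rw [← hcard x (by simpa using hx), ← ncard_coe_finset]
  congr 1
  ext c
  simp

theorem labelN_ne_zero (hfin : (Theta M).Finite) (A : ThetaBar M) : labelN A ≠ 0 := by
  obtain ⟨a, ha⟩ := exists_mem A
  exact ncard_ne_zero_of_mem ha (hfin.subset fun x hx => mem_theta_of_mem hx)

end Orbits

end CTreeStar

/-! ### Rigidity of the labeled tree -/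

namespace CTreeStar

variable {M : Type u} [CSet M]

theorem enatCard_subtype_subtype {α : Type*} (p q : α → Prop) :
    ENat.card {x : {x // p x} // q x} = {x | p x ∧ q x}.encard :=
  ENat.card_congr (Equiv.subtypeSubtypeEquivSubtypeInter p q)

theorem exists_equiv_freeCones [Countable M] {a a' : CTreeStar M}
    (h : ∀ τ, coneCount a τ = coneCount a' τ) :
    ∃ e : {G // G ∈ conesAt a ∧ Disjoint G (Theta M)} ≃
        {G // G ∈ conesAt a' ∧ Disjoint G (Theta M)},
      ∀ G, TreeLang.completeTheory (e G).1 = TreeLang.completeTheory G.1 := by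
  have hcount : ∀ a : CTreeStar M, Countable {G // G ∈ conesAt a ∧ Disjoint G (Theta M)} := by
    intro a
    refine ((countable_range (treeCone a)).mono ?_).to_subtype
    rintro _ ⟨⟨y, -, rfl⟩, -⟩
    exact ⟨y, rfl⟩
  have := hcount a
  have := hcount a'
  refine exists_equiv_of_card_fiber_eq
    (fun G : {G // G ∈ conesAt a ∧ Disjoint G (Theta M)} => TreeLang.completeTheory G.1)
    (fun G : {G // G ∈ conesAt a' ∧ Disjoint G (Theta M)} => TreeLang.completeTheory G.1)
    fun τ => ?_
  have key : ∀ a : CTreeStar M, ENat.card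
      {G : {G // G ∈ conesAt a ∧ Disjoint G (Theta M)} // TreeLang.completeTheory G.1 = τ} =
      coneCount a τ := by
    intro a
    rw [enatCard_subtype_subtype (fun G => G ∈ conesAt a ∧ Disjoint G (Theta M))
      (fun G => TreeLang.completeTheory G = τ), coneCount]
    simp only [and_assoc]
  rw [key, key, h]

theorem _root_.IsLabeledTreeAut.isPredOf_iff {σ : Equiv.Perm (ThetaBar M)} (hσ : IsLabeledTreeAut σ)
    {A B : ThetaBar M} : IsPredOf (σ A) (σ B) ↔ IsPredOf A B := by
  refine and_congr (hσ.lt_iff A B) (not_congr ⟨?_, ?_⟩)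
  · rintro ⟨D, h1, h2⟩
    obtain ⟨D, rfl⟩ := σ.surjective D
    exact ⟨D, (hσ.lt_iff _ _).1 h1, (hσ.lt_iff _ _).1 h2⟩
  · rintro ⟨D, h1, h2⟩
    exact ⟨σ D, (hσ.lt_iff _ _).2 h1, (hσ.lt_iff _ _).2 h2⟩

theorem encard_succ_of_isPredOf (hfin : (Theta M).Finite) {A C : ThetaBar M} {a : CTreeStar M}
    (ha : a ∈ A.1) (h : IsPredOf A C) :
    {c | IsSuccOf a c ∧ c ∈ C.1}.encard = {c | c ∈ C.1 ∧ a < c}.ncard := by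
  have heq : {c | IsSuccOf a c ∧ c ∈ C.1} = {c | c ∈ C.1 ∧ a < c} := by
    ext c
    exact ⟨fun hc => ⟨hc.2, hc.1.2.1⟩,
      fun hc => ⟨(CTreeStar.isPredOf_iff hfin ha hc.1 hc.2).1 h, hc.1⟩⟩
  rw [heq, Finite.cast_ncard_eq (hfin.subset fun x hx => mem_theta_of_mem hx.1)]

theorem encard_succ_of_not_isPredOf (hfin : (Theta M).Finite) {A C : ThetaBar M}
    {a : CTreeStar M} (ha : a ∈ A.1) (h : ¬ IsPredOf A C) :
    {c | IsSuccOf a c ∧ c ∈ C.1}.encard = 0 := by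
  rw [encard_eq_zero, eq_empty_iff_forall_notMem]
  exact fun c hc => h ((CTreeStar.isPredOf_iff hfin ha hc.2 hc.1.2.1).2 hc.1)

/-- The number of successors in `C` of a point of `A` is `n_C / n_A` if `A = C⁻` and zero otherwise;
`σ` preserves both cases. -/
theorem exists_equiv_succ [Countable M] (hfin : (Theta M).Finite)
    {σ : Equiv.Perm (ThetaBar M)} (hσ : IsLabeledTreeAut σ) {A : ThetaBar M}
    {a a' : CTreeStar M} (ha : a ∈ A.1) (ha' : a' ∈ (σ A).1) :
    ∃ e : {c // IsSuccOf a c} ≃ {c // IsSuccOf a' c},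
      ∀ c, ∀ C : ThetaBar M, c.1 ∈ C.1 → (e c).1 ∈ (σ C).1 := by
  have horb : ∀ (a : CTreeStar M) (c : {c // IsSuccOf a c}), ∃ C : ThetaBar M, c.1 ∈ C.1 :=
    fun a c => exists_mem_thetaBar c.2.1
  choose o ho using horb
  have ho' : ∀ (a) (c : {c // IsSuccOf a c}) (C : ThetaBar M), o a c = C ↔ c.1 ∈ C.1 :=
    fun a c C => ⟨fun h => h ▸ ho a c, fun h => eq_of_mem (ho a c) h⟩
  obtain ⟨e, he⟩ := exists_equiv_of_card_fiber_eq (o a) (fun c => σ.symm (o a' c)) (by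
    intro C
    simp only [Equiv.symm_apply_eq, ho']
    rw [enatCard_subtype_subtype (IsSuccOf a) (· ∈ C.1),
      enatCard_subtype_subtype (IsSuccOf a') (· ∈ (σ C).1)]
    by_cases h : IsPredOf A C
    · have h' := hσ.isPredOf_iff.2 h
      rw [encard_succ_of_isPredOf hfin ha h, encard_succ_of_isPredOf hfin ha' h', Nat.cast_inj]
      have h1 := labelN_eq_mul hfin h ha
      have h2 := labelN_eq_mul hfin h' ha'
      rw [hσ.labelN_eq, hσ.labelN_eq, h1] at h2
      exact Nat.eq_of_mul_eq_mul_left (Nat.pos_of_ne_zero (labelN_ne_zero hfin A)) h2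
    · rw [encard_succ_of_not_isPredOf hfin ha h,
        encard_succ_of_not_isPredOf hfin ha' (mt hσ.isPredOf_iff.1 h)])
  refine ⟨e, fun c C hc => ?_⟩
  have := he c
  rw [Equiv.symm_apply_eq, (ho' a c C).2 hc] at this
  exact (ho' _ _ _).1 this

theorem exists_setIso_prunedCone [Countable M] [Nonempty M] (hM : HasFinitelyManyTypes CLang M)
    (hfin : (Theta M).Finite) {σ : Equiv.Perm (ThetaBar M)} (hσ : IsLabeledTreeAut σ)
    {A C : ThetaBar M} {a c a' c' : CTreeStar M} (h : IsPredOf A C) (ha : a ∈ A.1) (hc : c ∈ C.1)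
    (hac : a < c) (ha' : a' ∈ (σ A).1) (hc' : c' ∈ (σ C).1) (hac' : a' < c') :
    ∃ f, SetIso (prunedCone a c) (prunedCone a' c') f ∧
      ∀ x ∈ prunedCone a c, f x < c' ↔ x < c := by
  have hlabel := hσ.labelEdge_eq A C h
  by_cases hne : (prunedCone a c).Nonempty
  · have hmem : prunedTheory a c ∈ labelEdge A C := ⟨a, ha, c, hc, hac, hne, rfl⟩
    rw [← hlabel] at hmem
    obtain ⟨b, hb, d, hd, hbd, -, hτ⟩ := hmem
    -- The label provides some pair of comparable points of the two orbits; all such pairs are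
    -- conjugate.
    obtain ⟨g, rfl, rfl⟩ := exists_treeIso_pair hfin hb hd hbd ha' hc' hac'
    exact exists_setIso_of_prunedTheory_eq hM (hτ.trans (prunedTheory_map (treeIso g) b d).symm)
  · have hne' : ¬ (prunedCone a' c').Nonempty := by
      intro hne'
      have hmem : prunedTheory a' c' ∈ labelEdge (σ A) (σ C) :=
        ⟨a', ha', c', hc', hac', hne', rfl⟩
      rw [hlabel] at hmem
      obtain ⟨b, hb, d, hd, hbd, hbd', -⟩ := hmem
      obtain ⟨g, rfl, rfl⟩ := exists_treeIso_pair hfin hb hd hbd ha hc hac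
      exact hne (prunedCone_nonempty_map g hbd')
    rw [not_nonempty_iff_eq_empty] at hne hne'
    rw [hne, hne']
    exact ⟨id, ⟨bijOn_empty _, by simp⟩, by simp⟩

theorem treeCone_eq_of_le {a x y z w : CTreeStar M} (hx : x ∈ treeCone a z)
    (hy : y ∈ treeCone a w) (hxy : x ≤ y) : treeCone a z = treeCone a w := by
  rw [mem_treeCone] at hx hy
  have h1 : a < x ⊓ w :=
    lt_inf_trans (by rw [inf_eq_left.2 hxy]; exact hx.trans_le inf_le_left) hy
  rw [inf_comm] at hx
  have h2 := lt_inf_trans hx h1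
  ext t
  rw [mem_treeCone, mem_treeCone]
  refine ⟨fun h => lt_inf_trans h h2, fun h => lt_inf_trans h ?_⟩
  rwa [inf_comm]

/-- The cones at `a`: those without element of `Θ`, and those of the successors of `a` in `Θ`. -/
def indexedCone (a : CTreeStar M) :
    {G // G ∈ conesAt a ∧ Disjoint G (Theta M)} ⊕ {c // IsSuccOf a c} → Set (CTreeStar M) :=
  Sum.elim (fun G => G.1) fun c => treeCone a c.1

theorem self_mem_treeCone {a x : CTreeStar M} (h : a < x) : x ∈ treeCone a x :=
  mem_treeCone.2 (by rwa [inf_idem])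

theorem lt_iff_exists_mem_indexedCone (hfin : (Theta M).Finite) (a x : CTreeStar M) :
    a < x ↔ ∃ i, x ∈ indexedCone a i := by
  constructor
  · intro hax
    by_cases hdisj : Disjoint (treeCone a x) (Theta M)
    · exact ⟨.inl ⟨treeCone a x, ⟨x, hax, rfl⟩, hdisj⟩, self_mem_treeCone hax⟩
    · obtain ⟨c, ⟨hcx, hc⟩, hmin⟩ := (hfin.subset (inter_subset_right :
        treeCone a x ∩ Theta M ⊆ Theta M)).exists_minimal (not_disjoint_iff_nonempty_inter.1 hdisj)
      rw [mem_treeCone] at hcx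
      refine ⟨.inr ⟨c, hc, hcx.trans_le inf_le_left, fun y hy hay hyc => ?_⟩, ?_⟩
      · have : y ∈ treeCone a x :=
          mem_treeCone.2 (lt_inf_trans (y := c) (by rwa [inf_eq_left.2 hyc.le]) hcx)
        exact hyc.not_ge (hmin ⟨this, hy⟩ hyc.le)
      · change x ∈ treeCone a c
        rw [mem_treeCone, inf_comm]
        exact hcx
  · rintro ⟨G | c, hx⟩
    · obtain ⟨y, -, hy⟩ := G.2.1
      have hx' : x ∈ G.1 := hx
      rw [hy, mem_treeCone] at hx'
      exact hx'.trans_le inf_le_left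
    · exact (mem_treeCone.1 hx).trans_le inf_le_left

theorem eq_of_indexedCone_le {a : CTreeStar M}
    (i j : {G // G ∈ conesAt a ∧ Disjoint G (Theta M)} ⊕ {c // IsSuccOf a c})
    (x : CTreeStar M) (hx : x ∈ indexedCone a i) (y : CTreeStar M) (hy : y ∈ indexedCone a j)
    (hxy : x ≤ y) : i = j := by
  have hcone : ∀ i : {G // G ∈ conesAt a ∧ Disjoint G (Theta M)} ⊕ {c // IsSuccOf a c},
      ∃ z, indexedCone a i = treeCone a z := by
    rintro (⟨_, ⟨y, -, h⟩, -⟩ | c)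
    · exact ⟨y, h⟩
    · exact ⟨c.1, rfl⟩
  have heq : indexedCone a i = indexedCone a j := by
    obtain ⟨z, hz⟩ := hcone i
    obtain ⟨w, hw⟩ := hcone j
    rw [hz] at hx
    rw [hw] at hy
    rw [hz, hw]
    exact treeCone_eq_of_le hx hy hxy
  rcases i with G | c <;> rcases j with G' | c'
  · exact congrArg Sum.inl (Subtype.ext heq)
  · exact absurd c'.2.1 (disjoint_left.1 G.2.2
      (heq.ge (show c'.1 ∈ indexedCone a (.inr c') from self_mem_treeCone c'.2.2.1)))
  · exact absurd c.2.1 (disjoint_left.1 G'.2.2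
      (heq.le (show c.1 ∈ indexedCone a (.inr c) from self_mem_treeCone c.2.2.1)))
  · have hmem : c.1 ∈ treeCone a c'.1 := heq.le (show c.1 ∈ indexedCone a (.inr c) from self_mem_treeCone c.2.2.1)
    rw [mem_treeCone] at hmem
    -- Two successors of `a` in the same cone have their meet in `Θ` and above `a`, hence coincide
    -- with it.
    have hΘ := inf_mem_theta c.2.1 c'.2.1
    have h1 := eq_of_le_of_not_lt inf_le_left (c.2.2.2 _ hΘ hmem)
    have h2 := eq_of_le_of_not_lt inf_le_right (c'.2.2.2 _ hΘ hmem)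
    exact congrArg Sum.inr (Subtype.ext (h1.symm.trans h2))

/-- A labeled tree automorphism preserves the isomorphism type of the thick cones. -/
theorem exists_setIso_Ici [Countable M] [Nonempty M] (hM : HasFinitelyManyTypes CLang M)
    (hfin : (Theta M).Finite) {σ : Equiv.Perm (ThetaBar M)} (hσ : IsLabeledTreeAut σ) (n : ℕ) :
    ∀ {A : ThetaBar M} {a a' : CTreeStar M}, a ∈ A.1 → a' ∈ (σ A).1 →
      {x | x ∈ Theta M ∧ a < x}.ncard = n → ∃ f, SetIso (Ici a) (Ici a') f := by
  induction n using Nat.strong_induction_on with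
  | _ n ih =>
    intro A a a' ha ha' hn
    obtain ⟨e₁, he₁⟩ := exists_equiv_freeCones
      (coneCount_eq_of_labelK_eq (hσ.labelK_eq A).symm ha ha')
    obtain ⟨e₂, he₂⟩ := exists_equiv_succ hfin hσ ha ha'
    refine exists_setIso_Ici_of_cones (indexedCone a) (indexedCone a')
      (lt_iff_exists_mem_indexedCone hfin a) (lt_iff_exists_mem_indexedCone hfin a')
      eq_of_indexedCone_le eq_of_indexedCone_le (e₁.sumCongr e₂) ?_
    rintro (G | c)
    · obtain ⟨y, -, hy⟩ := G.2.1
      obtain ⟨y', -, hy'⟩ := (e₁ G).2.1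
      have h := he₁ G
      change ∃ f, SetIso G.1 (e₁ G).1 f
      revert h
      generalize (e₁ G).1 = G' at hy'
      generalize G.1 = G₀ at hy
      subst hy hy'
      exact fun h => exists_setIso_of_completeTheory_eq hM h.symm
    · obtain ⟨C, hC⟩ := exists_mem_thetaBar c.2.1
      have hC' := he₂ c C hC
      have hac := c.2.2.1
      have hac' := (e₂ c).2.2.1
      have hpred := (isPredOf_iff hfin ha hC hac).2 c.2
      obtain ⟨f, hf, hfV⟩ := exists_setIso_prunedCone hM hfin hσ hpred ha hC hac ha' hC' hac'
      -- The induction decreases because `c` itself is above `a` but not above `c`.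
      obtain ⟨g, hg⟩ := ih _ (by
        rw [← hn]
        refine ncard_lt_ncard ⟨fun x hx => ⟨hx.1, hac.trans hx.2⟩, fun h => ?_⟩
          (hfin.subset fun x hx => hx.1)
        exact lt_irrefl _ (h ⟨c.2.1, hac⟩).2) hC hC' rfl
      obtain ⟨F, hF, -⟩ := exists_setIso_treeCone hac hac' hf hfV hg
      exact ⟨F, hF⟩

/-- Induction on the number of points of `Θ` below `a`. The isomorphisms used need not respect `Θ`:
once extended to the whole tree they come from automorphisms of `M`, which is all that orbits
require. -/
theorem labeledTreeAut_apply_eq [Countable M] (hM : HasFinitelyManyTypes CLang M)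
    (hfin : (Theta M).Finite) {σ : Equiv.Perm (ThetaBar M)} (hσ : IsLabeledTreeAut σ) (n : ℕ) :
    ∀ {A : ThetaBar M} {a : CTreeStar M}, a ∈ A.1 → {x | x ∈ Theta M ∧ x < a}.ncard = n →
      σ A = A := by
  induction n using Nat.strong_induction_on with
  | _ n ih =>
    intro A a ha hn
    have := nonempty_of_thetaBar A
    by_cases hmin : {x | x ∈ Theta M ∧ x < a}.Nonempty
    · obtain ⟨b, ⟨hb, hba⟩, hmax⟩ := (hfin.subset fun x hx => hx.1).exists_forall_le_of_isChain
        hmin (isChain_of_le fun x hx => hx.2.le)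
      obtain ⟨B, hB⟩ := exists_mem_thetaBar hb
      have hsucc : IsSuccOf b a :=
        ⟨mem_theta_of_mem ha, hba, fun x hx hbx hxa => hbx.not_ge (hmax x ⟨hx, hxa⟩)⟩
      have hpred := (isPredOf_iff hfin hB ha hba).2 hsucc
      have hσB : σ B = B := ih _ (by
        rw [← hn]
        refine ncard_lt_ncard ⟨fun x hx => ⟨hx.1, hx.2.trans hba⟩, fun h => ?_⟩
          (hfin.subset fun x hx => hx.1)
        exact lt_irrefl _ (h ⟨hb, hba⟩).2) hB rfl
      have hpred' : IsPredOf B (σ A) := by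
        have := hσ.isPredOf_iff.2 hpred
        rwa [hσB] at this
      obtain ⟨a', ha', hba'⟩ := hpred'.1.1 b hB
      have hsucc' := (isPredOf_iff hfin hB ha' hba').1 hpred'
      -- `a` and `a'` are successors of the same `b`. Either their cones at `b` are distinct and get
      -- swapped, or they coincide and so do `a` and `a'`.
      by_cases hdisj : Disjoint (treeCone b a) (treeCone b a')
      · have hB' : b ∈ (σ B).1 := by rwa [hσB]
        obtain ⟨f, hf, hfV⟩ :=
          exists_setIso_prunedCone hM hfin hσ hpred hB ha hba hB' ha' hba'
        obtain ⟨g, hg⟩ := exists_setIso_Ici hM hfin hσ _ ha ha' rfl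
        obtain ⟨F, hF, hFa⟩ := exists_setIso_treeCone hba hba' hf hfV hg
        obtain ⟨θ, hθ⟩ := exists_orderIso_swap hba hdisj hF
        obtain ⟨k, rfl⟩ := exists_treeIso_eq θ
        rw [hFa] at hθ
        exact eq_of_mem ha' (hθ ▸ treeIso_mem ha k)
      · obtain ⟨t, ht, ht'⟩ := not_disjoint_iff.1 hdisj
        rw [mem_treeCone] at ht ht'
        rw [inf_comm] at ht
        have hlt := lt_inf_trans ht ht'
        have hΘ := inf_mem_theta hsucc.1 hsucc'.1
        have h1 := eq_of_le_of_not_lt inf_le_left (hsucc.2.2 _ hΘ hlt)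
        have h2 := eq_of_le_of_not_lt inf_le_right (hsucc'.2.2 _ hΘ hlt)
        exact eq_of_mem ha' (h2.symm.trans h1 ▸ ha)
    -- Closure under meets turns the minimal element `a` into the least element of `Θ`.
    · have hle : ∀ y ∈ Theta M, a ≤ y := fun y hy => by
        have h1 := inf_mem_theta (mem_theta_of_mem ha) hy
        exact inf_eq_left.1 (eq_of_le_of_not_lt inf_le_left fun h => hmin ⟨_, h1, h⟩)
      obtain ⟨a', ha'⟩ := exists_mem (σ A)
      rcases eq_or_lt_of_le (hle a' (mem_theta_of_mem ha')) with h | h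
      · exact eq_of_mem ha' (h ▸ ha)
      -- If `σ A` were strictly above `A`, then `A` would be strictly above `σ⁻¹ A`, against
      -- minimality of `a`.
      · have hlt := antichainLT_of_lt ha ha' h
        have hlt' : AntichainLT (σ.symm A).1 A.1 := by
          rw [← hσ.lt_iff, σ.apply_symm_apply]
          exact hlt
        obtain ⟨x, hx, hxa⟩ := hlt'.2 a ha
        exact absurd ⟨x, mem_theta_of_mem hx, hxa⟩ hmin

theorem card_cLang_le : CLang.card ≤ Cardinal.aleph0 := by
  have h1 : ∀ n, Countable (CLang.Relations n) := fun n => by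
    have : Function.Injective fun _ : CRel n => () := fun a b _ => by
      cases a
      cases b
      rfl
    exact this.countable
  have h2 : ∀ n, Countable (CLang.Functions n) := fun n => inferInstanceAs (Countable Empty)
  have : Countable CLang.Symbols := inferInstanceAs (Countable ((Σ n, _) ⊕ (Σ n, _)))
  exact Cardinal.mk_le_aleph0

end CTreeStar

theorem proposition10 (M : Type u) [CSet M] [Countable M]
    (hcat : AlephZeroCategorical M) (hmin : CMinimal M)
    (σ : Equiv.Perm (ThetaBar M)) (hσ : IsLabeledTreeAut σ) :
    σ = Equiv.refl (ThetaBar M) := by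
  have hM : HasFinitelyManyTypes CLang M :=
    hasFinitelyManyTypes_of_categorical CTreeStar.card_cLang_le hcat
  obtain ⟨F, hFin, hF⟩ := hmin.exists_finite_agreesOver hM
  ext1 A
  obtain ⟨a, ha⟩ := CTreeStar.exists_mem A
  exact CTreeStar.labeledTreeAut_apply_eq hM (CTreeStar.finite_theta_of_agreesOver hFin hF) hσ _ ha
    rfl
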